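/- **Setting.** Let $N\ge 2$, $0\le\alpha\le1$, $0<\theta\le\pi/4$. Put $|\psi_\theta\rangle=\cos\theta|00\rangle+\sin\theta|11\rangle$ and let $\rho_{\alpha,\theta}=\alpha|\psi_\theta\rangle\langle\psi_\theta|+(1-\alpha)\,\mathrm{Tr}_B(|\psi_\theta\rangle\langle\psi_\theta|)\otimes\frac{\mathbb 1}{2}$, a two-qubit state of systems $A,B$. Take $N$ copies, with systems $A_1,B_1,\dots,A_N,B_N$, and let $F=|0\rangle(\langle 0\cdots0|+\langle1\cdots1|)$ act on $B_1\cdots B_N$. Let $\rho_{A_1\cdots A_N}$ be the $N$-qubit state obtained by normalising $\mathrm{Tr}_B[(\mathbb 1_A\otimes F)\rho_{\alpha,\theta}^{\otimes N}(\mathbb 1_A\otimes F)^\dagger]$. For a set $S$ of parties let $\rho_S$ be its reduced state on $S$, and define the $N$-qutrit state (qutrit basis $|0\rangle,|1\rangle,|2\rangle$) $$\rho_{\rm GME}=\frac1{2^N}\sum_{S\subseteq\{1,\dots,N\}}\rho_S\otimes(|2\rangle\langle2|)^{\otimes S^c}.$$ Let $G_\epsilon=\epsilon|0\rangle\langle0|+|1\rangle\langle1|$,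 let $\rho_\epsilon=G_\epsilon^{\otimes N}\rho_{\rm GME}G_\epsilon^{\otimes N}/\mathrm{Tr}[G_\epsilon^{\otimes N}\rho_{\rm GME}G_\epsilon^{\otimes N}]$, and let $|\mathrm{GHZ}\rangle=(|0\rangle^{\otimes N}+|1\rangle^{\otimes N})/\sqrt2$. **Notions.** A *bipartition* splits the $N$ parties into two non-empty blocks. An $N$-party state is *genuinely multipartite entangled* (GME) if it is not a finite convex combination of pure states each of which is a product across some bipartition. It is *fully local* if, for all families of local POVMs $M_{a_n|x_n}$ with finitely many outcomes, $\mathrm{Tr}[\rho\bigotimes_n M_{a_n|x_n}]=\int\prod_n p_\lambda(a_n|x_n)\,d\mu(\lambda)$ for some probability measure $\mu$ and local response functions $p_\lambda$. Correlations $p(\mathbf a|\mathbf x)$ are *bilocal* if $p(\mathbf a|\mathbf x)=\sum_{(b,\bar b)}p_b\int p^b_\lambda(\mathbf a_b|\mathbf x_b)\,p^b_\lambda(\mathbf a_{\bar b}|\mathbf x_{\bar b})\,d\mu_b(\lambda)$, where $(b,\bar b)$ runs over the bipartitions, the $p_b$ are probability weights, the $\mu_b$ are probability measures, and the distributions inside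 a block are arbitrary (possibly signalling). A state is *genuinely multipartite nonlocal* (GMNL) if finitely many local POVMs on it yield correlations that are not bilocal. It is *GMNL under sequential measurements* if there are local measurements with Kraus operators $K_{c|z}$ ($\sum_cK_{c|z}^\dagger K_{c|z}=\mathbb 1$), followed by local POVMs $M_{a|x}$ on the resulting systems (finitely many inputs and outcomes), whose joint statistics $p(\mathbf c,\mathbf a|\mathbf z,\mathbf x)$ have no time-ordered bilocal model, i.e. no model of the above form in which each block has a response $p_\lambda(\mathbf c_b|\mathbf z_b)\,p_\lambda(\mathbf a_b|\mathbf x_b,\mathbf c_b,\mathbf z_b)$. **Theorem.** Let $N\ge2$. 1. For all $0\le\alpha\le1$ and $0<\theta\le\pi/4$, $\rho_{\rm GME}$ and $\rho_{\tan\theta}$ are (well-defined) states and $$\langle\mathrm{GHZ}|\rho_{\tan\theta}|\mathrm{GHZ}\rangle=\tfrac12\Big[\alpha^N+\big(\tfrac{1+\alpha}2\big)^N+\big(\tfrac{1-\alpha}2\big)^N\Big].$$ 2. This fidelity tends to $1$ as $\alpha\to1^-$, for any choice of $\theta=\theta(\alpha)\in(0,\pi/4]$. 3. There is $\alpha_0<1$,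 depending only on $N$, such that for every $\alpha\in(\alpha_0,1)$: (a) some $\theta\in(0,\pi/4]$ satisfies $\cos^2(2\theta)\ge\frac{2\alpha-1}{(2-\alpha)\alpha^3}$; (b) for every $\theta\in(0,\pi/4]$, $\rho_{\rm GME}$ is GME, the filtered state $\rho_{\tan\theta}$ is GMNL, and $\rho_{\rm GME}$ is GMNL under sequential measurements; (c) if moreover $\theta$ satisfies the inequality in (a), then $\rho_{\rm GME}$ is fully local. In particular, for every $N\ge2$ there are fully local GME states that exhibit genuine multipartite hidden nonlocality. -/

import Mathlib

namespace HiddenNonlocality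

open Matrix MeasureTheory
open scoped Kronecker ComplexOrder

noncomputable section

/-! ### States of `N` parties

Each party holds a copy of `ℂ^d` with basis `Fin d`; the joint space has the product basis
`Fin N → Fin d`, and operators are matrices in that basis. -/

/-- Operators on `(ℂ^d)^{⊗N}`. -/
abbrev MultiOp (N d : ℕ) := Matrix (Fin N → Fin d) (Fin N → Fin d) ℂ

/-- Density operators. -/
def IsState {ι : Type} [Fintype ι] (ρ : Matrix ι ι ℂ) : Prop :=
  ρ.PosSemidef ∧ ρ.trace = 1

/-- The product operator `M 0 ⊗ ⋯ ⊗ M (N-1)`. -/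
def tensor {N d : ℕ} (M : Fin N → Matrix (Fin d) (Fin d) ℂ) : MultiOp N d :=
  Matrix.of fun i j => ∏ n, M n (i n) (j n)

/-- The rank-one operator `|v⟩⟨v|`. -/
def ketbra {ι : Type} (v : ι → ℂ) : Matrix ι ι ℂ := vecMulVec v (star v)

/-- Partial trace over the second tensor factor. -/
def traceRight {ι κ : Type} [Fintype κ] (M : Matrix (ι × κ) (ι × κ) ℂ) : Matrix ι ι ℂ :=
  Matrix.of fun i j => ∑ k, M (i, k) (j, k)

/-- Division of an operator by its trace. -/
def normalize {ι : Type} [Fintype ι] (M : Matrix ι ι ℂ) : Matrix ι ι ℂ :=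
  (M.trace)⁻¹ • M

/-! ### Genuine multipartite entanglement -/

/-- The bipartitions `(b, bᶜ)` of the parties, both blocks being non-empty. (Each unordered
bipartition is listed once for each choice of its first block, which changes no mixture.) -/
def bipartitions (N : ℕ) : Finset (Finset (Fin N)) :=
  Finset.univ.filter fun b => b.Nonempty ∧ bᶜ.Nonempty

/-- The product vector `Φ_b ⊗ Ψ_{bᶜ}`. -/
def bipartiteVec {N d : ℕ} (b : Finset (Fin N))
    (Φ : (b → Fin d) → ℂ) (Ψ : ((bᶜ : Finset (Fin N)) → Fin d) → ℂ) : (Fin N → Fin d) → ℂ :=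
  fun i => Φ (fun n => i n) * Ψ (fun n => i n)

/-- Biseparability: `ρ = ∑_b p_b ∑_j q^b_j |Φ_j⟩⟨Φ_j|_b ⊗ |Ψ_j⟩⟨Ψ_j|_{bᶜ}`. -/
def IsBiseparable {N d : ℕ} (ρ : MultiOp N d) : Prop :=
  ∃ (k : ℕ) (p : Finset (Fin N) → ℝ) (q : Finset (Fin N) → Fin k → ℝ)
    (Φ : (b : Finset (Fin N)) → Fin k → (b → Fin d) → ℂ)
    (Ψ : (b : Finset (Fin N)) → Fin k → ((bᶜ : Finset (Fin N)) → Fin d) → ℂ),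
    (∀ b ∈ bipartitions N, 0 ≤ p b) ∧ ∑ b ∈ bipartitions N, p b = 1 ∧
    (∀ b ∈ bipartitions N, (∀ j, 0 ≤ q b j) ∧ ∑ j, q b j = 1) ∧
    (∀ b ∈ bipartitions N, ∀ j, star (Φ b j) ⬝ᵥ Φ b j = 1 ∧ star (Ψ b j) ⬝ᵥ Ψ b j = 1) ∧
    ρ = ∑ b ∈ bipartitions N, (p b : ℂ) •
          ∑ j, (q b j : ℂ) • ketbra (bipartiteVec b (Φ b j) (Ψ b j))

/-- Genuinely multipartite entangled states. -/
def IsGME {N d : ℕ} (ρ : MultiOp N d) : Prop :=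
  IsState ρ ∧ ¬ IsBiseparable ρ

/-! ### Measurements and correlations -/

/-- `M x a` are the measurement operators of POVMs labelled by `x` with outcomes `a`. -/
def IsPOVM {d : ℕ} {X A : Type} [Fintype A] (M : X → A → Matrix (Fin d) (Fin d) ℂ) : Prop :=
  ∀ x, (∀ a, (M x a).PosSemidef) ∧ ∑ a, M x a = 1

/-- The statistics `p(a|x) = Tr[ρ ⨂ₙ M_{aₙ|xₙ}]`. -/
def born {N d : ℕ} {X A : Type} (ρ : MultiOp N d)
    (M : Fin N → X → A → Matrix (Fin d) (Fin d) ℂ) (x : Fin N → X) (a : Fin N → A) : ℝ :=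
  (ρ * tensor fun n => M n (x n) (a n)).trace.re

/-- `P i` is, for every input `i`, a probability distribution over outputs. -/
def IsResponse {I O : Type} [Fintype O] (P : I → O → ℝ) : Prop :=
  ∀ i, (∀ o, 0 ≤ P i o) ∧ ∑ o, P i o = 1

/-- Correlations with a (fully) local hidden variable model
`p(a|x) = ∫ p_l(a₁|x₁) ⋯ p_l(a_N|x_N) dμ(l)`. -/
def HasLHVModel {N : ℕ} {X A : Type} [Fintype A]
    (p : (Fin N → X) → (Fin N → A) → ℝ) : Prop :=
  ∃ (L : Type) (_ : MeasurableSpace L) (μ : Measure L) (P : Fin N → L → X → A → ℝ),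
    IsProbabilityMeasure μ ∧
    (∀ n l, IsResponse (P n l)) ∧
    (∀ n x a, Measurable fun l => P n l x a) ∧
    ∀ x a, p x a = ∫ l, ∏ n, P n l (x n) (a n) ∂μ

/-- A state is fully local if for all families of local POVMs, with an arbitrary (possibly
infinite) set of labels, the statistics have a local hidden variable model. The label set may be
the set of all POVMs, so that one model serves all measurements at once. -/
def IsFullyLocal {N d : ℕ} (ρ : MultiOp N d) : Prop :=
  ∀ (X A : Type) [Fintype A] (M : Fin N → X → A → Matrix (Fin d) (Fin d) ℂ),
    (∀ n, IsPOVM (M n)) → HasLHVModel (born ρ M)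

/-- Correlations that are mixtures of correlations each local across some bipartition,
`p(a|x) = ∑_b w_b ∫ P_l(a_b|x_b) Q_l(a_{bᶜ}|x_{bᶜ}) dμ_b(l)`, where the distributions within a
block are unrestricted (they may be signalling). -/
def IsBilocal {N : ℕ} {X A : Type} [Fintype A]
    (p : (Fin N → X) → (Fin N → A) → ℝ) : Prop :=
  ∃ (L : Type) (_ : MeasurableSpace L) (w : Finset (Fin N) → ℝ)
    (μ : Finset (Fin N) → Measure L)
    (P : (b : Finset (Fin N)) → L → (b → X) → (b → A) → ℝ)
    (Q : (b : Finset (Fin N)) → L →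
      ((bᶜ : Finset (Fin N)) → X) → ((bᶜ : Finset (Fin N)) → A) → ℝ),
    (∀ b ∈ bipartitions N, 0 ≤ w b) ∧ ∑ b ∈ bipartitions N, w b = 1 ∧
    (∀ b ∈ bipartitions N, IsProbabilityMeasure (μ b)) ∧
    (∀ b ∈ bipartitions N, ∀ l, IsResponse (P b l) ∧ IsResponse (Q b l)) ∧
    (∀ b ∈ bipartitions N, ∀ x a, Measurable fun l => P b l x a) ∧
    (∀ b ∈ bipartitions N, ∀ x a, Measurable fun l => Q b l x a) ∧
    ∀ x a, p x a = ∑ b ∈ bipartitions N, w b *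
      ∫ l, P b l (fun n => x n) (fun n => a n) * Q b l (fun n => x n) (fun n => a n) ∂(μ b)

/-- Genuine multipartite nonlocality of a state: finitely many local POVMs with finitely many
outcomes give statistics which are not bilocal. -/
def IsGMNL {N d : ℕ} (ρ : MultiOp N d) : Prop :=
  ∃ (m k : ℕ) (M : Fin N → Fin m → Fin k → Matrix (Fin d) (Fin d) ℂ),
    (∀ n, IsPOVM (M n)) ∧ ¬ IsBilocal (born ρ M)

/-! ### Sequences of two local measurements -/

/-- `K z c` are the Kraus operators of measurements labelled by `z` with outcomes `c`; outcome `c`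
transforms the state by `σ ↦ K σ Kᴴ`. -/
def IsInstrument {d : ℕ} {Z C : Type} [Fintype C]
    (K : Z → C → Matrix (Fin d) (Fin d) ℂ) : Prop :=
  ∀ z, ∑ c, (K z c)ᴴ * K z c = 1

/-- Statistics `p(c,a|z,x)` when every party first performs a measurement with Kraus operators
`K_{c|z}` and then the POVM `M_{a|x}` on the resulting system. -/
def seqBorn {N d : ℕ} {Z C X A : Type} (ρ : MultiOp N d)
    (K : Fin N → Z → C → Matrix (Fin d) (Fin d) ℂ)
    (M : Fin N → X → A → Matrix (Fin d) (Fin d) ℂ)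
    (z : Fin N → Z) (c : Fin N → C) (x : Fin N → X) (a : Fin N → A) : ℝ :=
  ((tensor fun n => K n (z n) (c n)) * ρ * (tensor fun n => K n (z n) (c n))ᴴ *
    tensor fun n => M n (x n) (a n)).trace.re

/-- Time-ordered bilocal models of sequential correlations: given the hidden variable, a block of
a bipartition produces its first outcomes from its first inputs alone, and then its second outcomes
from its second inputs and the whole history of the block. -/
def IsSeqBilocal {N : ℕ} {Z C X A : Type} [Fintype C] [Fintype A]
    (p : (Fin N → Z) → (Fin N → C) → (Fin N → X) → (Fin N → A) → ℝ) : Prop :=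
  ∃ (L : Type) (_ : MeasurableSpace L) (w : Finset (Fin N) → ℝ)
    (μ : Finset (Fin N) → Measure L)
    (P₁ : (b : Finset (Fin N)) → L → (b → Z) → (b → C) → ℝ)
    (P₂ : (b : Finset (Fin N)) → L → (b → Z) → (b → C) → (b → X) → (b → A) → ℝ)
    (Q₁ : (b : Finset (Fin N)) → L →
      ((bᶜ : Finset (Fin N)) → Z) → ((bᶜ : Finset (Fin N)) → C) → ℝ)
    (Q₂ : (b : Finset (Fin N)) → L →
      ((bᶜ : Finset (Fin N)) → Z) → ((bᶜ : Finset (Fin N)) → C) →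
      ((bᶜ : Finset (Fin N)) → X) → ((bᶜ : Finset (Fin N)) → A) → ℝ),
    (∀ b ∈ bipartitions N, 0 ≤ w b) ∧ ∑ b ∈ bipartitions N, w b = 1 ∧
    (∀ b ∈ bipartitions N, IsProbabilityMeasure (μ b)) ∧
    (∀ b ∈ bipartitions N, ∀ l, IsResponse (P₁ b l) ∧ IsResponse (Q₁ b l)) ∧
    (∀ b ∈ bipartitions N, ∀ l z c, IsResponse (P₂ b l z c)) ∧
    (∀ b ∈ bipartitions N, ∀ l z c, IsResponse (Q₂ b l z c)) ∧
    (∀ b ∈ bipartitions N, ∀ z c, Measurable fun l => P₁ b l z c) ∧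
    (∀ b ∈ bipartitions N, ∀ z c x a, Measurable fun l => P₂ b l z c x a) ∧
    (∀ b ∈ bipartitions N, ∀ z c, Measurable fun l => Q₁ b l z c) ∧
    (∀ b ∈ bipartitions N, ∀ z c x a, Measurable fun l => Q₂ b l z c x a) ∧
    ∀ z c x a, p z c x a = ∑ b ∈ bipartitions N, w b *
      ∫ l, (P₁ b l (fun n => z n) (fun n => c n) *
            P₂ b l (fun n => z n) (fun n => c n) (fun n => x n) (fun n => a n)) *
           (Q₁ b l (fun n => z n) (fun n => c n) *
            Q₂ b l (fun n => z n) (fun n => c n) (fun n => x n) (fun n => a n)) ∂(μ b)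

/-- Genuine multipartite nonlocality under sequences of local measurements. -/
def IsSeqGMNL {N d : ℕ} (ρ : MultiOp N d) : Prop :=
  ∃ (mz kc m k : ℕ) (K : Fin N → Fin mz → Fin kc → Matrix (Fin d) (Fin d) ℂ)
    (M : Fin N → Fin m → Fin k → Matrix (Fin d) (Fin d) ℂ),
    (∀ n, IsInstrument (K n)) ∧ (∀ n, IsPOVM (M n)) ∧ ¬ IsSeqBilocal (seqBorn ρ K M)

/-! ### The states -/

/-- `|ψ_θ⟩ = cos θ |00⟩ + sin θ |11⟩`. -/
def psi (θ : ℝ) : Fin 2 × Fin 2 → ℂ :=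
  (Real.cos θ : ℂ) • Pi.single (0, 0) 1 + (Real.sin θ : ℂ) • Pi.single (1, 1) 1

/-- `ρ_{α,θ} = α |ψ_θ⟩⟨ψ_θ| + (1 - α) Tr_B |ψ_θ⟩⟨ψ_θ| ⊗ 𝟙/2`, the first factor being Alice's. -/
def rhoPair (α θ : ℝ) : Matrix (Fin 2 × Fin 2) (Fin 2 × Fin 2) ℂ :=
  (α : ℂ) • ketbra (psi θ) +
    (1 - α : ℂ) • (traceRight (ketbra (psi θ)) ⊗ₖ ((1 / 2 : ℂ) • (1 : Matrix (Fin 2) (Fin 2) ℂ)))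

/-- `ρ^{⊗N}` for a two-qubit operator, arranged as an operator on
`(A₁ ⊗ ⋯ ⊗ A_N) ⊗ (B₁ ⊗ ⋯ ⊗ B_N)`. -/
def starPower (N : ℕ) (ρ : Matrix (Fin 2 × Fin 2) (Fin 2 × Fin 2) ℂ) :
    Matrix ((Fin N → Fin 2) × (Fin N → Fin 2)) ((Fin N → Fin 2) × (Fin N → Fin 2)) ℂ :=
  Matrix.of fun i j => ∏ n, ρ (i.1 n, i.2 n) (j.1 n, j.2 n)

/-- `F_B = |0⟩(⟨0⋯0| + ⟨1⋯1|)`. -/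
def centralKraus (N : ℕ) : Matrix (Fin 2) (Fin N → Fin 2) ℂ :=
  vecMulVec (Pi.single 0 1) (Pi.single (fun _ => 0) 1 + Pi.single (fun _ => 1) 1)

/-- `ρ_{A₁⋯A_N}`: apply `σ ↦ F_B σ F_Bᴴ` to the central systems of `ρ_{α,θ}^{⊗N}`, trace them out
and normalise. -/
def rhoNetwork (N : ℕ) (α θ : ℝ) : MultiOp N 2 :=
  normalize (traceRight
    (((1 : MultiOp N 2) ⊗ₖ centralKraus N) * starPower N (rhoPair α θ) *
      ((1 : MultiOp N 2) ⊗ₖ centralKraus N)ᴴ))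

/-- The reduced state of the parties in `S`. -/
def reduced {N : ℕ} (S : Finset (Fin N)) (ρ : MultiOp N 2) :
    Matrix (S → Fin 2) (S → Fin 2) ℂ :=
  Matrix.of fun i j => ∑ k : ((Sᶜ : Finset (Fin N)) → Fin 2),
    ρ (fun n => if h : n ∈ S then i ⟨n, h⟩ else k ⟨n, Finset.mem_compl.2 h⟩)
      (fun n => if h : n ∈ S then j ⟨n, h⟩ else k ⟨n, Finset.mem_compl.2 h⟩)

/-- The isometry `|i⟩_S ↦ |i⟩_S ⊗ |2⋯2⟩_{Sᶜ}` from the qubits of the parties in `S` into `N`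
qutrits. -/
def padTwo {N : ℕ} (S : Finset (Fin N)) : Matrix (Fin N → Fin 3) (S → Fin 2) ℂ :=
  Matrix.of fun t i =>
    if t = (fun n => if h : n ∈ S then (i ⟨n, h⟩).castSucc else 2) then 1 else 0

/-- `ρ_GME`, the uniform mixture over all sets `S` of parties (`S` being everyone for the first
term) of `ρ_S ⊗ |2⟩⟨2|^{⊗ Sᶜ}`, where `ρ_S` is the reduced state of `ρ_{A₁⋯A_N}`. -/
def rhoGME (N : ℕ) (α θ : ℝ) : MultiOp N 3 :=
  (1 / 2 ^ N : ℂ) • ∑ S : Finset (Fin N),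
    padTwo S * reduced S (rhoNetwork N α θ) * (padTwo S)ᴴ

/-- The filter `G_ε = ε |0⟩⟨0| + |1⟩⟨1|` on a qutrit. -/
def filterOp (ε : ℝ) : Matrix (Fin 3) (Fin 3) ℂ := Matrix.diagonal ![(ε : ℂ), 1, 0]

/-- The state obtained from `ρ` when all parties succeed with the filter `G_ε`. -/
def filtered {N : ℕ} (ε : ℝ) (ρ : MultiOp N 3) : MultiOp N 3 :=
  normalize ((tensor fun _ => filterOp ε) * ρ * (tensor fun _ => filterOp ε))

/-- `|GHZ⟩ = (|0⋯0⟩ + |1⋯1⟩)/√2` in `N` qutrits. -/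
def ghz (N : ℕ) : (Fin N → Fin 3) → ℂ :=
  ((1 / Real.sqrt 2 : ℝ) : ℂ) • (Pi.single (fun _ => 0) 1 + Pi.single (fun _ => 1) 1)

/-- The fidelity `⟨v|ρ|v⟩` of `ρ` with the pure state `|v⟩⟨v|`. -/
def fidelityPure {ι : Type} [Fintype ι] (ρ : Matrix ι ι ℂ) (v : ι → ℂ) : ℂ :=
  star v ⬝ᵥ (ρ *ᵥ v)

/-- The sufficient condition on `(α, θ)` for `ρ_{α,θ}` to be unsteerable. -/
def UnsteerableCond (α θ : ℝ) : Prop :=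
  (2 * α - 1) / ((2 - α) * α ^ 3) ≤ Real.cos (2 * θ) ^ 2

end

end HiddenNonlocality

open HiddenNonlocality Filter Topology

namespace HiddenNonlocality

open Matrix MeasureTheory
open scoped Kronecker ComplexOrder

noncomputable section

/-! The whole proof rests on one factorisation. The central projection keeps only `|0⋯0⟩ + |1⋯1⟩`,
so the network operator is `∑_{s,t} ⊗ₙ ⟨s|ρ_{α,θ}|t⟩`. The uniform mixture over `S` acts on each
party separately, replacing its qubit by the flag `|2⟩` with probability `1/2`. Hence every product
statistic of `rhoGME` is, up to normalisation, a sum over four pairs `(s, t)` of products of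
one-party functionals (`trace_rhoGME_mul_tensor`).

Nonlocal side. The filter `G_{tan θ}` annihilates the flag and, because `tan θ cos θ = sin θ`,
equalises the two populations, so the filtered state does not depend on `θ` (`blockFun_filterOp`)
and approaches GHZ as `α → 1`. GHZ beats the Svetlichny bound by a factor `√2`, and `α ^ N ≥ 3/4`
keeps the violation (`svetlichny_violation`). The bound itself is CHSH between the two blocks of a
bipartition. It is proved for subnormalised models (`svetlichny_le`), so that it also applies to a
time-ordered model conditioned on the event that every filter succeeds. GME follows from a witness
which, after filtering, says that biseparable states have GHZ fidelity at most `1/2`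
(`witness_ketbra_nonneg`).

Local side. Under the stated inequality Alice cannot steer Bob with `ρ_{α,θ}`: each of her qubit
effects is reproduced by a response function of a Gaussian vector `ψ`, Bob holding `√ρ_B |ψ⟩⟨ψ|
√ρ_B` (`exists_pair_response`). The building blocks are spherical caps, which make the eigenvalue
gap as large as `τ (2 - τ) / 2` at trace `τ` (`exists_response`). When all the central systems carry
such hidden states, the central projection only reweights the distribution of `(ψ₁, …, ψ_N)`, and
the outer parties still respond independently. Effects are simulated one at a time, so the responses
of a POVM need not sum to `1`, only to at most `2`. The flag, present half of the time, absorbs the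
difference (`integral_paddedResponse`), and this is how arbitrary POVMs are covered.

The two sides are compatible because nonlocality holds for every `θ` once `α` is near `1`, while
unsteerability holds for `θ` small enough depending on `α`. -/

/-! ### Splitting configurations along a set of parties -/

/-- The configuration equal to `k` on `S` and to `m` on `Sᶜ`. -/
def glue {N : ℕ} {β : Type} (S : Finset (Fin N)) (k : S → β)
    (m : (Sᶜ : Finset (Fin N)) → β) : Fin N → β :=
  fun n => if h : n ∈ S then k ⟨n, h⟩ else m ⟨n, Finset.mem_compl.2 h⟩

lemma glue_mem {N : ℕ} {β : Type} (S : Finset (Fin N)) (k : S → β)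
    (m : (Sᶜ : Finset (Fin N)) → β) (n : S) : glue S k m n = k n := by
  simp [glue]

lemma glue_compl {N : ℕ} {β : Type} (S : Finset (Fin N)) (k : S → β)
    (m : (Sᶜ : Finset (Fin N)) → β) (n : (Sᶜ : Finset (Fin N))) : glue S k m n = m n := by
  have := Finset.mem_compl.1 n.2
  simp [glue, this]

/-- Configurations are pairs of configurations on `S` and on `Sᶜ`. -/
def glueEquiv {N : ℕ} {β : Type} (S : Finset (Fin N)) :
    (S → β) × ((Sᶜ : Finset (Fin N)) → β) ≃ (Fin N → β) where
  toFun q := glue S q.1 q.2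
  invFun x := (fun n => x n, fun n => x n)
  left_inv q := by
    ext n
    · exact glue_mem S q.1 q.2 n
    · exact glue_compl S q.1 q.2 n
  right_inv x := by
    ext n
    simp [glue]

lemma sum_glue {N : ℕ} {β M : Type} [Fintype β] [AddCommMonoid M] (S : Finset (Fin N))
    (F : (Fin N → β) → M) : ∑ x, F x = ∑ k, ∑ m, F (glue S k m) := by
  rw [← (glueEquiv S).sum_comp, Fintype.sum_prod_type]
  rfl

lemma prod_split {N : ℕ} {M : Type} [CommMonoid M] (S : Finset (Fin N)) (f : Fin N → M) :
    ∏ n, f n = (∏ n : S, f n) * ∏ n : (Sᶜ : Finset (Fin N)), f n := by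
  rw [← Finset.prod_mul_prod_compl S f, Finset.prod_coe_sort S f, Finset.prod_coe_sort Sᶜ f]

lemma trace_mul_tensor {N d : ℕ} (A : MultiOp N d) (M : Fin N → Matrix (Fin d) (Fin d) ℂ) :
    (A * tensor M).trace = ∑ i, ∑ j, A i j * ∏ n, M n (j n) (i n) := by
  simp [Matrix.trace, Matrix.mul_apply, tensor]

lemma sum_sum_prod {N : ℕ} {β R : Type} [Fintype β] [CommSemiring R]
    (f : Fin N → β → β → R) :
    ∑ i : Fin N → β, ∑ j : Fin N → β, ∏ n, f n (i n) (j n) = ∏ n, ∑ a, ∑ b, f n a b := by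
  simp_rw [Finset.prod_univ_sum, Fintype.piFinset_univ]

lemma sum_comm_pair {ι κ R : Type} [Fintype ι] [Fintype κ] [AddCommMonoid R]
    (f : ι → ι → κ → κ → R) :
    ∑ i, ∑ j, ∑ s, ∑ t, f i j s t = ∑ s, ∑ t, ∑ i, ∑ j, f i j s t := by
  calc ∑ i, ∑ j, ∑ s, ∑ t, f i j s t
      = ∑ q : ι × ι, ∑ r : κ × κ, f q.1 q.2 r.1 r.2 := by
        simp only [Fintype.sum_prod_type]
    _ = ∑ r : κ × κ, ∑ q : ι × ι, f q.1 q.2 r.1 r.2 := Finset.sum_comm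
    _ = ∑ s, ∑ t, ∑ i, ∑ j, f i j s t := by
        simp only [Fintype.sum_prod_type]

/-! ### The network state -/

/-- The network state before normalisation. -/
def networkOp (N : ℕ) (α θ : ℝ) : MultiOp N 2 :=
  traceRight (((1 : MultiOp N 2) ⊗ₖ centralKraus N) * starPower N (rhoPair α θ) *
      ((1 : MultiOp N 2) ⊗ₖ centralKraus N)ᴴ)

lemma starPower_apply (N : ℕ) (ρ : Matrix (Fin 2 × Fin 2) (Fin 2 × Fin 2) ℂ)
    (i k j l : Fin N → Fin 2) :
    starPower N ρ (i, k) (j, l) = ∏ n, ρ (i n, k n) (j n, l n) := rfl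

/-- The Kraus operator only sees constant strings on the central systems, so two bits `s`, `t`
shared by all parties remain and the rest factorises over parties. -/
lemma networkOp_apply (N : ℕ) (α θ : ℝ) (i j : Fin N → Fin 2) :
    networkOp N α θ i j = ∑ s, ∑ t, ∏ n, rhoPair α θ (i n, s) (j n, t) := by
  have h (k : Fin 2) (y : Fin N → Fin 2) : centralKraus N k y =
      if k = 0 then ((if y = (fun _ => 0) then 1 else 0) + if y = (fun _ => 1) then 1 else 0)
        else 0 := by
    simp [centralKraus, vecMulVec_apply, Pi.single_apply]
  simp only [networkOp, traceRight, of_apply, Matrix.mul_apply, Fintype.sum_prod_type,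
    kroneckerMap_apply, conjTranspose_apply, h, Matrix.one_apply, Fin.sum_univ_two]
  simp only [↓reduceIte, one_ne_zero, mul_zero, zero_mul, Finset.sum_const_zero, star_zero,
    ite_mul, one_mul, Finset.sum_ite_eq, Finset.mem_univ,
    add_mul, Finset.sum_add_distrib, mul_ite, Finset.sum_ite_eq', apply_ite star, star_add,
    star_one, mul_add, mul_one, add_zero, starPower_apply]
  ring

lemma padTwo_apply {N : ℕ} (S : Finset (Fin N)) (t : Fin N → Fin 3) (i : S → Fin 2) :
    padTwo S t i = if t = glue S (fun n => (i n).castSucc) (fun _ => 2) then 1 else 0 := rfl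

lemma reduced_apply {N : ℕ} (S : Finset (Fin N)) (ρ : MultiOp N 2) (i j : S → Fin 2) :
    reduced S ρ i j = ∑ k, ρ (glue S i k) (glue S j k) := rfl

/-- By cyclicity the isometry compresses the product operator: parties in `S` contribute their qubit
block, the others the scalar `M n 2 2`. -/
lemma trace_padTwo_mul_tensor {N : ℕ} (S : Finset (Fin N)) (R : Matrix (S → Fin 2) (S → Fin 2) ℂ)
    (M : Fin N → Matrix (Fin 3) (Fin 3) ℂ) :
    (padTwo S * R * (padTwo S)ᴴ * tensor M).trace =
      ∑ k, ∑ l, R k l * ((∏ n : S, M n (l n).castSucc (k n).castSucc) *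
        ∏ n : (Sᶜ : Finset (Fin N)), M n 2 2) := by
  rw [Matrix.mul_assoc, Matrix.mul_assoc, Matrix.trace_mul_comm, Matrix.mul_assoc]
  have h (l k : S → Fin 2) : ((padTwo S)ᴴ * tensor M * padTwo S) l k =
      (∏ n : S, M n (l n).castSucc (k n).castSucc) *
        ∏ n : (Sᶜ : Finset (Fin N)), M n 2 2 := by
    simp [Matrix.mul_apply, padTwo_apply, tensor, prod_split S, glue_mem, glue_compl]
  rw [Matrix.trace]
  refine Finset.sum_congr rfl fun k _ => ?_
  rw [diag_apply, Matrix.mul_apply]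
  exact Finset.sum_congr rfl fun l _ => by rw [h]

/-- The mixture over all subsets `S` is a product of independent local channels, which is the
expansion of a product of binomials read backwards. The Kronecker delta accompanying `M n 2 2` is
the partial trace over a party outside `S`. -/
lemma trace_rhoGME_mul_tensor_eq_sum {N : ℕ} (α θ : ℝ) (M : Fin N → Matrix (Fin 3) (Fin 3) ℂ) :
    (rhoGME N α θ * tensor M).trace = (1 / 2 ^ N : ℂ) * ∑ i, ∑ j, rhoNetwork N α θ i j *
      ∏ n, (M n (j n).castSucc (i n).castSucc + if i n = j n then M n 2 2 else 0) := by
  rw [rhoGME, smul_mul_assoc, trace_smul, smul_eq_mul, Finset.sum_mul, trace_sum]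
  congr 1
  have hS (S : Finset (Fin N)) :
      (padTwo S * reduced S (rhoNetwork N α θ) * (padTwo S)ᴴ * tensor M).trace =
        ∑ i, ∑ j, rhoNetwork N α θ i j * ((∏ n ∈ S, M n (j n).castSucc (i n).castSucc) *
          ∏ n ∈ Sᶜ, if i n = j n then M n 2 2 else 0) := by
    have hδ (m m' : (Sᶜ : Finset (Fin N)) → Fin 2) :
        (∏ n : (Sᶜ : Finset (Fin N)), if m n = m' n then M n 2 2 else 0) =
          if m = m' then ∏ n : (Sᶜ : Finset (Fin N)), M n 2 2 else 0 := by
      simp_rw [Finset.prod_ite_zero, funext_iff, Finset.mem_univ, forall_const]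
    simp_rw [← Finset.prod_coe_sort S, ← Finset.prod_coe_sort Sᶜ]
    rw [trace_padTwo_mul_tensor, sum_glue S]
    refine Finset.sum_congr rfl fun k _ => ?_
    simp_rw [fun k m => sum_glue S (fun j => rhoNetwork N α θ (glue S k m) j *
      ((∏ n : S, M n (j n).castSucc (glue S k m n).castSucc) *
        ∏ n : (Sᶜ : Finset (Fin N)), if glue S k m n = j n then M n 2 2 else 0)),
      glue_mem, glue_compl, hδ]
    rw [Finset.sum_comm]
    refine Finset.sum_congr rfl fun l _ => ?_
    simp [reduced_apply, Finset.sum_mul]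
  -- Expanding the product of sums on the right produces one term per subset `S`.
  simp_rw [hS, Fintype.prod_add, Finset.mul_sum]
  rw [Finset.sum_comm]
  exact Finset.sum_congr rfl fun i _ => Finset.sum_comm

/-- The functional `M ↦ Tr[⟨s|ρ_{α,θ}|t⟩ M]` of an effective qubit operator, in terms of the
qutrit operator measured. -/
def blockFun (α θ : ℝ) (s t : Fin 2) (M : Matrix (Fin 3) (Fin 3) ℂ) : ℂ :=
  ∑ i : Fin 2, ∑ j : Fin 2, rhoPair α θ (i, s) (j, t) *
    (M j.castSucc i.castSucc + if i = j then M 2 2 else 0)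

/-- The master formula: traces, the filtered state and the local model are all computed from it. -/
lemma trace_rhoGME_mul_tensor {N : ℕ} (α θ : ℝ) (M : Fin N → Matrix (Fin 3) (Fin 3) ℂ) :
    (rhoGME N α θ * tensor M).trace = (1 / 2 ^ N : ℂ) * (networkOp N α θ).trace⁻¹ *
      ∑ s, ∑ t, ∏ n, blockFun α θ s t (M n) := by
  rw [trace_rhoGME_mul_tensor_eq_sum, mul_assoc]
  congr 1
  have h (i j) : rhoNetwork N α θ i j = (networkOp N α θ).trace⁻¹ * networkOp N α θ i j := rfl
  simp_rw [h, mul_assoc, ← Finset.mul_sum, networkOp_apply, blockFun, ← sum_sum_prod,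
    Finset.prod_mul_distrib, Finset.sum_mul]
  congr 1
  exact sum_comm_pair _

lemma rhoPair_zero_zero (α θ : ℝ) (i j : Fin 2) : rhoPair α θ (i, 0) (j, 0) =
    diagonal ![((Real.cos θ ^ 2 * ((1 + α) / 2) : ℝ) : ℂ),
      ((Real.sin θ ^ 2 * ((1 - α) / 2) : ℝ) : ℂ)] i j := by
  fin_cases i <;> fin_cases j <;>
    simp [rhoPair, ketbra, psi, traceRight, vecMulVec_apply, -Complex.ofReal_cos,
      -Complex.ofReal_sin] <;> ring

lemma rhoPair_one_one (α θ : ℝ) (i j : Fin 2) : rhoPair α θ (i, 1) (j, 1) =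
    diagonal ![((Real.cos θ ^ 2 * ((1 - α) / 2) : ℝ) : ℂ),
      ((Real.sin θ ^ 2 * ((1 + α) / 2) : ℝ) : ℂ)] i j := by
  fin_cases i <;> fin_cases j <;>
    simp [rhoPair, ketbra, psi, traceRight, vecMulVec_apply, -Complex.ofReal_cos,
      -Complex.ofReal_sin] <;> ring

lemma rhoPair_zero_one (α θ : ℝ) (i j : Fin 2) : rhoPair α θ (i, 0) (j, 1) =
    single 0 1 ((α * Real.cos θ * Real.sin θ : ℝ) : ℂ) i j := by
  fin_cases i <;> fin_cases j <;>
    simp [rhoPair, ketbra, psi, traceRight, vecMulVec_apply, -Complex.ofReal_cos,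
      -Complex.ofReal_sin]
  ring

lemma rhoPair_one_zero (α θ : ℝ) (i j : Fin 2) : rhoPair α θ (i, 1) (j, 0) =
    single 1 0 ((α * Real.cos θ * Real.sin θ : ℝ) : ℂ) i j := by
  fin_cases i <;> fin_cases j <;>
    simp [rhoPair, ketbra, psi, traceRight, vecMulVec_apply, -Complex.ofReal_cos,
      -Complex.ofReal_sin]
  ring

lemma blockFun_zero_zero (α θ : ℝ) (M : Matrix (Fin 3) (Fin 3) ℂ) : blockFun α θ 0 0 M =
    ((Real.cos θ ^ 2 * ((1 + α) / 2) : ℝ) : ℂ) * (M 0 0 + M 2 2) +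
      ((Real.sin θ ^ 2 * ((1 - α) / 2) : ℝ) : ℂ) * (M 1 1 + M 2 2) := by
  simp [blockFun, rhoPair_zero_zero, -Complex.ofReal_cos, -Complex.ofReal_sin]

lemma blockFun_one_one (α θ : ℝ) (M : Matrix (Fin 3) (Fin 3) ℂ) : blockFun α θ 1 1 M =
    ((Real.cos θ ^ 2 * ((1 - α) / 2) : ℝ) : ℂ) * (M 0 0 + M 2 2) +
      ((Real.sin θ ^ 2 * ((1 + α) / 2) : ℝ) : ℂ) * (M 1 1 + M 2 2) := by
  simp [blockFun, rhoPair_one_one, -Complex.ofReal_cos, -Complex.ofReal_sin]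

lemma blockFun_zero_one (α θ : ℝ) (M : Matrix (Fin 3) (Fin 3) ℂ) : blockFun α θ 0 1 M =
    ((α * Real.cos θ * Real.sin θ : ℝ) : ℂ) * M 1 0 := by
  simp [blockFun, rhoPair_zero_one, -Complex.ofReal_cos, -Complex.ofReal_sin]

lemma blockFun_one_zero (α θ : ℝ) (M : Matrix (Fin 3) (Fin 3) ℂ) : blockFun α θ 1 0 M =
    ((α * Real.cos θ * Real.sin θ : ℝ) : ℂ) * M 0 1 := by
  simp [blockFun, rhoPair_one_zero, -Complex.ofReal_cos, -Complex.ofReal_sin]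

/-- The diagonal of Bob's reduced state. -/
def bobWeight (α θ : ℝ) : Fin 2 → ℝ :=
  ![Real.cos θ ^ 2 * ((1 + α) / 2) + Real.sin θ ^ 2 * ((1 - α) / 2),
    Real.cos θ ^ 2 * ((1 - α) / 2) + Real.sin θ ^ 2 * ((1 + α) / 2)]

/-- The terms `s ≠ t` vanish because Bob's reduced state is diagonal; `N ≠ 0` is needed to turn
these zeros into zero powers. -/
lemma trace_networkOp {N : ℕ} (hN : N ≠ 0) (α θ : ℝ) :
    (networkOp N α θ).trace = ((∑ s, bobWeight α θ s ^ N : ℝ) : ℂ) := by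
  have h : (networkOp N α θ).trace =
      ∑ s, ∑ t, (∑ i, rhoPair α θ (i, s) (i, t)) ^ N := by
    simp_rw [Matrix.trace, diag_apply, networkOp_apply]
    rw [Finset.sum_comm]
    refine Finset.sum_congr rfl fun s _ => ?_
    rw [Finset.sum_comm]
    refine Finset.sum_congr rfl fun t _ => ?_
    have := Finset.prod_univ_sum (fun _ : Fin N => Finset.univ)
      (fun _ i => rhoPair α θ (i, s) (i, t))
    simpa using this.symm
  rw [h]
  simp [Fin.sum_univ_two, rhoPair_zero_zero, rhoPair_one_one, rhoPair_zero_one, rhoPair_one_zero,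
    hN, bobWeight, -Complex.ofReal_cos, -Complex.ofReal_sin]

lemma bobWeight_pos {α θ : ℝ} (hα : α ∈ Set.Icc (0 : ℝ) 1) (hc : Real.cos θ ≠ 0)
    (hs : Real.sin θ ≠ 0) (s : Fin 2) : 0 < bobWeight α θ s := by
  have h1 : 0 < Real.cos θ ^ 2 := by positivity
  have h2 : 0 < Real.sin θ ^ 2 := by positivity
  obtain ⟨h3, h4⟩ := hα
  fin_cases s <;> simp [bobWeight] <;> nlinarith

/-- The factor `2` counts the qubit and the flag contributions; over `N` parties it cancels the
weight `1 / 2 ^ N`. -/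
lemma blockFun_one (α θ : ℝ) (s t : Fin 2) :
    blockFun α θ s t 1 = if s = t then ((2 * bobWeight α θ s : ℝ) : ℂ) else 0 := by
  fin_cases s <;> fin_cases t <;>
  simp [blockFun_zero_zero, blockFun_one_one, blockFun_zero_one, blockFun_one_zero, bobWeight,
    -Complex.ofReal_cos, -Complex.ofReal_sin] <;> ring

lemma tensor_one {N d : ℕ} : tensor (fun _ : Fin N => (1 : Matrix (Fin d) (Fin d) ℂ)) = 1 := by
  ext i j
  simp_rw [tensor, of_apply, one_apply, Finset.prod_ite_zero, funext_iff, Finset.mem_univ,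
    forall_const, Finset.prod_const_one]

/-! ### Positivity -/

lemma ketbra_posSemidef {ι : Type} [Finite ι] (v : ι → ℂ) : (ketbra v).PosSemidef :=
  posSemidef_vecMulVec_self_star v

lemma PosSemidef.traceRight {ι κ : Type} [Fintype κ] {M : Matrix (ι × κ) (ι × κ) ℂ}
    (hM : M.PosSemidef) : (traceRight M).PosSemidef := by
  have : HiddenNonlocality.traceRight M = ∑ k, M.submatrix (fun i => (i, k)) (fun i => (i, k)) := by
    ext i j
    simp [HiddenNonlocality.traceRight, Matrix.sum_apply]
  rw [this]
  exact posSemidef_sum _ fun k _ => hM.submatrix _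

lemma rhoPair_posSemidef {α : ℝ} (hα : α ∈ Set.Icc (0 : ℝ) 1) (θ : ℝ) :
    (rhoPair α θ).PosSemidef := by
  have h1 : (0 : ℂ) ≤ α := by exact_mod_cast hα.1
  have h2 : (0 : ℂ) ≤ 1 - α := by
    have : (0 : ℝ) ≤ 1 - α := by linarith [hα.2]
    exact_mod_cast this
  have h3 : (0 : ℂ) ≤ 1 / 2 := by
    rw [Complex.le_def]
    norm_num
  exact ((ketbra_posSemidef _).smul h1).add
    (((PosSemidef.traceRight (ketbra_posSemidef _)).kronecker (PosSemidef.one.smul h3)).smul h2)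

open scoped MatrixOrder Matrix.Norms.L2Operator in
lemma PosSemidef.starPower {N : ℕ} {ρ : Matrix (Fin 2 × Fin 2) (Fin 2 × Fin 2) ℂ}
    (hρ : ρ.PosSemidef) : (starPower N ρ).PosSemidef := by
  obtain ⟨V, rfl⟩ := CStarAlgebra.nonneg_iff_eq_star_mul_self.mp hρ.nonneg
  have : HiddenNonlocality.starPower N (star V * V) =
      (Matrix.of fun (k : Fin N → Fin 2 × Fin 2) (i : (Fin N → Fin 2) × (Fin N → Fin 2)) =>
        ∏ n, V (k n) (i.1 n, i.2 n))ᴴ *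
      (Matrix.of fun (k : Fin N → Fin 2 × Fin 2) (i : (Fin N → Fin 2) × (Fin N → Fin 2)) =>
        ∏ n, V (k n) (i.1 n, i.2 n)) := by
    ext ⟨i, k⟩ ⟨j, l⟩
    simp only [starPower_apply, Matrix.mul_apply, star_apply, conjTranspose_apply, of_apply,
      Finset.prod_univ_sum, Fintype.piFinset_univ, star_prod, Finset.prod_mul_distrib]
  rw [this]
  exact posSemidef_conjTranspose_mul_self _

lemma networkOp_posSemidef {N : ℕ} {α : ℝ} (hα : α ∈ Set.Icc (0 : ℝ) 1) (θ : ℝ) :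
    (networkOp N α θ).PosSemidef :=
  PosSemidef.traceRight
    ((PosSemidef.starPower (rhoPair_posSemidef hα θ)).mul_mul_conjTranspose_same _)

lemma PosSemidef.normalize {ι : Type} [Fintype ι] {M : Matrix ι ι ℂ} (hM : M.PosSemidef) :
    (normalize M).PosSemidef :=
  hM.smul (inv_nonneg.2 hM.trace_nonneg)

lemma isState_normalize {ι : Type} [Fintype ι] {M : Matrix ι ι ℂ} (hM : M.PosSemidef)
    (h : M.trace ≠ 0) : IsState (normalize M) :=
  ⟨PosSemidef.normalize hM, by
    rw [HiddenNonlocality.normalize, trace_smul, smul_eq_mul, inv_mul_cancel₀ h]⟩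

lemma PosSemidef.reduced {N : ℕ} (S : Finset (Fin N)) {ρ : MultiOp N 2} (hρ : ρ.PosSemidef) :
    (reduced S ρ).PosSemidef := by
  have : HiddenNonlocality.reduced S ρ =
      ∑ k, ρ.submatrix (fun i => glue S i k) (fun i => glue S i k) := by
    ext i j
    simp [reduced_apply, Matrix.sum_apply]
  rw [this]
  exact posSemidef_sum _ fun k _ => hρ.submatrix _

lemma rhoGME_posSemidef {N : ℕ} {α : ℝ} (hα : α ∈ Set.Icc (0 : ℝ) 1) (θ : ℝ) :
    (rhoGME N α θ).PosSemidef := by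
  have h : (0 : ℂ) ≤ 1 / 2 ^ N := by
    simp
  exact (posSemidef_sum _ fun S _ => (PosSemidef.reduced S (PosSemidef.normalize
    (networkOp_posSemidef hα θ))).mul_mul_conjTranspose_same _).smul h

lemma trace_rhoGME {N : ℕ} (hN : N ≠ 0) {α θ : ℝ} (hα : α ∈ Set.Icc (0 : ℝ) 1)
    (hc : Real.cos θ ≠ 0) (hs : Real.sin θ ≠ 0) : (rhoGME N α θ).trace = 1 := by
  have h := trace_rhoGME_mul_tensor (N := N) α θ (fun _ => 1)
  have hZ : (∑ s, bobWeight α θ s ^ N : ℝ) ≠ 0 :=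
    (Finset.sum_pos (fun s _ => pow_pos (bobWeight_pos hα hc hs s) N) ⟨0, by simp⟩).ne'
  rw [tensor_one, mul_one, trace_networkOp hN] at h
  rw [h]
  simp only [blockFun_one, Finset.prod_const, Finset.card_univ, Fintype.card_fin, ite_pow,
    zero_pow hN, Finset.sum_ite_eq, Finset.mem_univ, if_true]
  have : ∑ s, ((2 * bobWeight α θ s : ℝ) : ℂ) ^ N =
      2 ^ N * ((∑ s, bobWeight α θ s ^ N : ℝ) : ℂ) := by
    push_cast
    simp_rw [mul_pow, Finset.mul_sum]
  rw [this]
  have hZ' : ((∑ s, bobWeight α θ s ^ N : ℝ) : ℂ) ≠ 0 := by exact_mod_cast hZ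
  field_simp

/-! ### The filtered state -/

lemma tensor_mul_tensor {N d : ℕ} (A B : Fin N → Matrix (Fin d) (Fin d) ℂ) :
    tensor A * tensor B = tensor fun n => A n * B n := by
  ext i j
  simp only [tensor, Matrix.mul_apply, of_apply, ← Finset.prod_mul_distrib,
    Finset.prod_univ_sum, Fintype.piFinset_univ]

/-- Matrix units are product operators, so formulas for product statistics also give the individual
matrix entries. -/
lemma trace_mul_tensor_single {N d : ℕ} (A : MultiOp N d) (i j : Fin N → Fin d) :
    (A * tensor fun n => single (j n) (i n) 1).trace = A i j := by
  have h (i' j' : Fin N → Fin d) : (∏ n, (single (j n) (i n) (1 : ℂ) (j' n) (i' n))) =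
      if j = j' ∧ i = i' then 1 else 0 := by
    simp_rw [single_apply, Finset.prod_ite_zero, funext_iff, Finset.mem_univ, forall_const,
      Finset.prod_const_one, forall_and]
  rw [trace_mul_tensor, Finset.sum_eq_single i, Finset.sum_eq_single j]
  · simp
  · intro j' _ hj
    simp [h, hj.symm]
  · simp
  · intro i' _ hi
    simp [h, hi.symm]
  · simp

/-- Filtering an operator by `G_ε` at each party, without normalisation. -/
def filterAll {N : ℕ} (ε : ℝ) (ρ : MultiOp N 3) : MultiOp N 3 :=
  (tensor fun _ => filterOp ε) * ρ * (tensor fun _ => filterOp ε)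

lemma trace_filterAll_mul_tensor {N : ℕ} (ε : ℝ) (ρ : MultiOp N 3)
    (M : Fin N → Matrix (Fin 3) (Fin 3) ℂ) :
    (filterAll ε ρ * tensor M).trace =
      (ρ * tensor fun n => filterOp ε * M n * filterOp ε).trace := by
  rw [filterAll, Matrix.mul_assoc, Matrix.mul_assoc, trace_mul_comm, Matrix.mul_assoc,
    ← tensor_mul_tensor, ← tensor_mul_tensor]

/-- The functional `M ↦ Tr[⟨s|ρ|t⟩ M]` for the pair state after filtering by `G_{tan θ}`, divided
by `sin² θ`. -/
def filtFun (α : ℝ) (s t : Fin 2) (M : Matrix (Fin 3) (Fin 3) ℂ) : ℂ :=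
  !![(1 + α) / 2 * M 0 0 + (1 - α) / 2 * M 1 1, α * M 1 0;
    α * M 0 1, (1 - α) / 2 * M 0 0 + (1 + α) / 2 * M 1 1] s t

/-- This is why the filter parameter is `tan θ`: each amplitude `cos θ` becomes `sin θ`, so all
dependence on `θ` leaves through a common factor that normalisation removes. -/
lemma blockFun_filterOp {θ : ℝ} (hc : Real.cos θ ≠ 0) (α : ℝ) (s t : Fin 2)
    (M : Matrix (Fin 3) (Fin 3) ℂ) :
    blockFun α θ s t (filterOp (Real.tan θ) * M * filterOp (Real.tan θ)) =
      ((Real.sin θ ^ 2 : ℝ) : ℂ) * filtFun α s t M := by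
  have h : Real.tan θ * Real.cos θ = Real.sin θ := Real.tan_mul_cos hc
  have h' : ((Real.tan θ : ℝ) : ℂ) * ((Real.cos θ : ℝ) : ℂ) = ((Real.sin θ : ℝ) : ℂ) := by
    exact_mod_cast h
  fin_cases s <;> fin_cases t <;>
  simp [blockFun_zero_zero, blockFun_one_one, blockFun_zero_one, blockFun_one_zero, filtFun,
    filterOp, diagonal_mul, mul_diagonal, -Complex.ofReal_cos, -Complex.ofReal_sin,
    -Complex.ofReal_tan, ← h'] <;> ring

/-- The weight of the filtered operator. -/
def filterWeight (N : ℕ) (α θ : ℝ) : ℝ :=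
  1 / 2 ^ N * (∑ s, bobWeight α θ s ^ N)⁻¹ * (Real.sin θ ^ 2) ^ N

lemma filterWeight_pos {N : ℕ} {α θ : ℝ} (hα : α ∈ Set.Icc (0 : ℝ) 1)
    (hc : Real.cos θ ≠ 0) (hs : Real.sin θ ≠ 0) : 0 < filterWeight N α θ := by
  have : 0 < ∑ s, bobWeight α θ s ^ N :=
    Finset.sum_pos (fun s _ => pow_pos (bobWeight_pos hα hc hs s) N) ⟨0, by simp⟩
  unfold filterWeight
  positivity

lemma trace_filterAll_rhoGME_mul_tensor {N : ℕ} (hN : N ≠ 0) (α : ℝ) {θ : ℝ}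
    (hc : Real.cos θ ≠ 0) (M : Fin N → Matrix (Fin 3) (Fin 3) ℂ) :
    (filterAll (Real.tan θ) (rhoGME N α θ) * tensor M).trace =
      (filterWeight N α θ : ℂ) * ∑ s, ∑ t, ∏ n, filtFun α s t (M n) := by
  rw [trace_filterAll_mul_tensor, trace_rhoGME_mul_tensor, trace_networkOp hN]
  simp_rw [blockFun_filterOp hc, Finset.prod_mul_distrib, ← Finset.mul_sum, Finset.prod_const,
    Finset.card_univ, Fintype.card_fin, filterWeight]
  push_cast
  ring

lemma trace_filterAll_rhoGME {N : ℕ} (hN : N ≠ 0) (α : ℝ) {θ : ℝ} (hc : Real.cos θ ≠ 0) :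
    (filterAll (Real.tan θ) (rhoGME N α θ)).trace = ((2 * filterWeight N α θ : ℝ) : ℂ) := by
  have h := trace_filterAll_rhoGME_mul_tensor hN α hc (fun _ => 1)
  rw [tensor_one, mul_one] at h
  rw [h]
  have h1 : ((1 : ℂ) + α) / 2 + (1 - α) / 2 = 1 := by ring
  have h2 : ((1 : ℂ) - α) / 2 + (1 + α) / 2 = 1 := by ring
  simp [filtFun, h1, h2, hN]
  ring

lemma filterOp_conjTranspose (ε : ℝ) : (filterOp ε)ᴴ = filterOp ε := by
  rw [filterOp, diagonal_conjTranspose]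
  congr 1
  ext k
  fin_cases k <;> simp

lemma tensor_filterOp_conjTranspose {N : ℕ} (ε : ℝ) :
    (tensor fun _ : Fin N => filterOp ε)ᴴ = tensor fun _ => filterOp ε := by
  ext i j
  simp only [conjTranspose_apply, tensor, of_apply, star_prod]
  refine Finset.prod_congr rfl fun n _ => ?_
  rw [← conjTranspose_apply, filterOp_conjTranspose]

lemma filterAll_posSemidef {N : ℕ} (ε : ℝ) {ρ : MultiOp N 3} (hρ : ρ.PosSemidef) :
    (filterAll ε ρ).PosSemidef := by
  have := hρ.mul_mul_conjTranspose_same (tensor fun _ : Fin N => filterOp ε)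
  rwa [tensor_filterOp_conjTranspose] at this

section Filtered

variable {N : ℕ} {α θ : ℝ}

lemma isState_filtered (hN : N ≠ 0) (hα : α ∈ Set.Icc (0 : ℝ) 1) (hc : Real.cos θ ≠ 0)
    (hs : Real.sin θ ≠ 0) : IsState (filtered (Real.tan θ) (rhoGME N α θ)) := by
  refine isState_normalize (filterAll_posSemidef _ (rhoGME_posSemidef hα θ)) ?_
  have := trace_filterAll_rhoGME hN α hc
  have h2 := (filterWeight_pos (N := N) hα hc hs).ne'
  rw [filterAll] at this
  rw [this]
  exact_mod_cast mul_ne_zero two_ne_zero h2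

lemma trace_filtered_mul_tensor (hN : N ≠ 0) (hα : α ∈ Set.Icc (0 : ℝ) 1)
    (hc : Real.cos θ ≠ 0) (hs : Real.sin θ ≠ 0) (M : Fin N → Matrix (Fin 3) (Fin 3) ℂ) :
    (filtered (Real.tan θ) (rhoGME N α θ) * tensor M).trace =
      1 / 2 * ∑ s, ∑ t, ∏ n, filtFun α s t (M n) := by
  have h : filtered (Real.tan θ) (rhoGME N α θ) =
    normalize (filterAll (Real.tan θ) (rhoGME N α θ)) := rfl
  have h2 : (filterWeight N α θ : ℂ) ≠ 0 := by
    exact_mod_cast (filterWeight_pos (N := N) hα hc hs).ne'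
  rw [h, normalize, smul_mul_assoc, trace_smul, trace_filterAll_rhoGME_mul_tensor hN α hc,
    trace_filterAll_rhoGME hN α hc, smul_eq_mul]
  push_cast
  field_simp

lemma filtered_apply (hN : N ≠ 0) (hα : α ∈ Set.Icc (0 : ℝ) 1)
    (hc : Real.cos θ ≠ 0) (hs : Real.sin θ ≠ 0) (i j : Fin N → Fin 3) :
    filtered (Real.tan θ) (rhoGME N α θ) i j =
      1 / 2 * ∑ s, ∑ t, ∏ n, filtFun α s t (single (j n) (i n) 1) := by
  rw [← trace_filtered_mul_tensor hN hα hc hs, trace_mul_tensor_single]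

lemma filtered_diag (hN : N ≠ 0) (hα : α ∈ Set.Icc (0 : ℝ) 1)
    (hc : Real.cos θ ≠ 0) (hs : Real.sin θ ≠ 0) (k : Fin 2) :
    filtered (Real.tan θ) (rhoGME N α θ) (fun _ => k.castSucc) (fun _ => k.castSucc) =
      ((1 / 2 * (((1 + α) / 2) ^ N + ((1 - α) / 2) ^ N) : ℝ) : ℂ) := by
  rw [filtered_apply hN hα hc hs]
  fin_cases k <;> simp [filtFun, hN, add_comm]

lemma filtered_zero_one (hN : N ≠ 0) (hα : α ∈ Set.Icc (0 : ℝ) 1)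
    (hc : Real.cos θ ≠ 0) (hs : Real.sin θ ≠ 0) :
    filtered (Real.tan θ) (rhoGME N α θ) (fun _ => 0) (fun _ => 1) =
      ((1 / 2 * α ^ N : ℝ) : ℂ) := by
  rw [filtered_apply hN hα hc hs]
  simp [filtFun, hN]

lemma filtered_one_zero (hN : N ≠ 0) (hα : α ∈ Set.Icc (0 : ℝ) 1)
    (hc : Real.cos θ ≠ 0) (hs : Real.sin θ ≠ 0) :
    filtered (Real.tan θ) (rhoGME N α θ) (fun _ => 1) (fun _ => 0) =
      ((1 / 2 * α ^ N : ℝ) : ℂ) := by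
  rw [filtered_apply hN hα hc hs]
  simp [filtFun, hN]

lemma fidelityPure_ghz (ρ : MultiOp N 3) : fidelityPure ρ (ghz N) =
    1 / 2 * (ρ (fun _ => 0) (fun _ => 0) + ρ (fun _ => 0) (fun _ => 1) +
      ρ (fun _ => 1) (fun _ => 0) + ρ (fun _ => 1) (fun _ => 1)) := by
  have h : ((Real.sqrt 2 : ℝ) : ℂ) * (Real.sqrt 2 : ℝ) = 2 := by
    exact_mod_cast Real.mul_self_sqrt (by norm_num : (0 : ℝ) ≤ 2)
  simp only [fidelityPure, ghz, mulVec_smul, mulVec_add, mulVec_single_one, star_smul, star_add,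
    smul_dotProduct, dotProduct_smul, dotProduct_add, add_dotProduct]
  have e (k : Fin N → Fin 3) : star (Pi.single k 1 : (Fin N → Fin 3) → ℂ) = Pi.single k 1 := by
    ext x
    by_cases hx : x = k <;> simp [hx]
  simp only [e, single_one_dotProduct, col_apply, smul_eq_mul]
  simp only [one_div, Complex.ofReal_inv, star_inv₀, RCLike.star_def, Complex.conj_ofReal]
  have h' : ((Real.sqrt 2 : ℝ) : ℂ)⁻¹ * ((Real.sqrt 2 : ℝ) : ℂ)⁻¹ = 2⁻¹ := by
    rw [← mul_inv, h]
  linear_combination (ρ (fun _ => 0) (fun _ => 0) + ρ (fun _ => 0) (fun _ => 1) +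
      ρ (fun _ => 1) (fun _ => 0) + ρ (fun _ => 1) (fun _ => 1)) * h'

lemma fidelity_filtered (hN : N ≠ 0) (hα : α ∈ Set.Icc (0 : ℝ) 1)
    (hc : Real.cos θ ≠ 0) (hs : Real.sin θ ≠ 0) :
    fidelityPure (filtered (Real.tan θ) (rhoGME N α θ)) (ghz N) =
        ((1 / 2 * (α ^ N + ((1 + α) / 2) ^ N + ((1 - α) / 2) ^ N) : ℝ) : ℂ) := by
  have h0 := filtered_diag hN hα hc hs 0
  have h1 := filtered_diag hN hα hc hs 1
  simp only [Fin.castSucc_zero, Fin.castSucc_one] at h0 h1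
  rw [fidelityPure_ghz, h0, h1, filtered_zero_one hN hα hc hs, filtered_one_zero hN hα hc hs]
  push_cast
  ring

end Filtered

/-! ### The Svetlichny inequality -/

section Phase

variable {κ : Type} [Fintype κ]

/-- The phase `i^{∑ yₙ}` of a string of binary inputs. -/
def phase (y : κ → Fin 2) : ℂ := ∏ n, ![1, Complex.I] (y n)

/-- The parity sign of a string of binary outputs. -/
def paritySign (a : κ → Fin 2) : ℝ := ∏ n, ![1, -1] (a n)

/-- The phase is a fourth root of unity, so exactly one of its coordinates is nonzero, and that one
is `±1`. The pair of equations expressing this is stable under multiplication. -/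
lemma phase_re_im (y : κ → Fin 2) :
    (phase y).re * (phase y).im = 0 ∧ (phase y).re ^ 2 + (phase y).im ^ 2 = 1 := by
  refine Finset.prod_induction _ (fun z : ℂ => z.re * z.im = 0 ∧ z.re ^ 2 + z.im ^ 2 = 1) ?_
    (by simp) ?_
  · rintro z w ⟨h1, h2⟩ ⟨h3, h4⟩
    simp only [Complex.mul_re, Complex.mul_im]
    constructor
    · linear_combination (w.re ^ 2 - w.im ^ 2) * h1 + (z.re ^ 2 - z.im ^ 2) * h3
    · linear_combination (w.re ^ 2 + w.im ^ 2) * h2 + h4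
  · intro n _
    generalize y n = k
    fin_cases k <;> simp

lemma abs_re_phase (y : κ → Fin 2) : |(phase y).re| = (1 + (phase y ^ 2).re) / 2 := by
  obtain ⟨h1, h2⟩ := phase_re_im y
  have h3 : |(phase y).re| = (phase y).re ^ 2 := by
    rcases mul_eq_zero.1 h1 with h | h
    · simp [h]
    · rw [← sq_abs]
      have : |(phase y).re| ^ 2 = 1 := by rw [sq_abs]; simpa [h] using h2
      nlinarith [abs_nonneg (phase y).re]
  rw [h3, pow_two (phase y), Complex.mul_re]
  linarith

lemma abs_im_phase (y : κ → Fin 2) : |(phase y).im| = (1 - (phase y ^ 2).re) / 2 := by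
  obtain ⟨h1, h2⟩ := phase_re_im y
  have h3 : |(phase y).im| = (phase y).im ^ 2 := by
    rcases mul_eq_zero.1 h1 with h | h
    · rw [← sq_abs]
      have : |(phase y).im| ^ 2 = 1 := by rw [sq_abs]; simpa [h] using h2
      nlinarith [abs_nonneg (phase y).im]
    · simp [h]
  rw [h3, pow_two (phase y), Complex.mul_re]
  linarith

lemma abs_paritySign (a : κ → Fin 2) : |paritySign a| = 1 := by
  rw [paritySign, Finset.abs_prod]
  refine Finset.prod_eq_one fun n _ => ?_
  generalize a n = k
  fin_cases k <;> simp

variable [DecidableEq κ]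

/-- The sum factorises and each factor is `1 + i² = 0`. So on a nonempty block half of the input
strings have a real phase and half an imaginary one, which gives the next two sums. -/
lemma sum_phase_sq [Nonempty κ] : ∑ y : κ → Fin 2, phase y ^ 2 = 0 := by
  have h : ∏ n : κ, ∑ k : Fin 2, (![1, Complex.I] k) ^ 2 = ∑ y : κ → Fin 2, phase y ^ 2 := by
    simp_rw [Finset.prod_univ_sum, Fintype.piFinset_univ, phase, Finset.prod_pow]
  rw [← h]
  simp

lemma sum_abs_re_phase [Nonempty κ] :
    ∑ y : κ → Fin 2, |(phase y).re| = 2 ^ Fintype.card κ / 2 := by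
  simp_rw [abs_re_phase, ← Finset.sum_div, Finset.sum_add_distrib, ← Complex.re_sum,
    sum_phase_sq]
  simp

lemma sum_abs_im_phase [Nonempty κ] :
    ∑ y : κ → Fin 2, |(phase y).im| = 2 ^ Fintype.card κ / 2 := by
  simp_rw [abs_im_phase, ← Finset.sum_div, Finset.sum_sub_distrib, ← Complex.re_sum,
    sum_phase_sq]
  simp

lemma abs_sum_mul_le {ι : Type} [Fintype ι] (A f : ι → ℝ) (hA : ∀ i, |A i| ≤ 1) :
    |∑ i, A i * f i| ≤ ∑ i, |f i| := by
  refine (Finset.abs_sum_le_sum_abs _ _).trans (Finset.sum_le_sum fun i _ => ?_)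
  rw [abs_mul]
  exact mul_le_of_le_one_left (abs_nonneg _) (hA i)

/-- The expected parity of the outputs of a response. -/
def parityMean (P : (κ → Fin 2) → (κ → Fin 2) → ℝ) (y : κ → Fin 2) : ℝ :=
  ∑ a, paritySign a * P y a

lemma abs_parityMean_le {P : (κ → Fin 2) → (κ → Fin 2) → ℝ} (hP : IsResponse P)
    (y : κ → Fin 2) : |parityMean P y| ≤ 1 := by
  refine (abs_sum_mul_le _ _ fun a => (abs_paritySign a).le).trans ?_
  rw [Finset.sum_congr rfl fun a _ => abs_of_nonneg ((hP y).1 a), (hP y).2]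

end Phase

/-- Group as `u₁ (v₁ + v₂) + u₂ (v₁ - v₂)` and use `|v₁ + v₂| + |v₁ - v₂| = 2 max(|v₁|, |v₂|)`. -/
lemma chsh_bound {u₁ u₂ v₁ v₂ m k : ℝ} (hu₁ : |u₁| ≤ m) (hu₂ : |u₂| ≤ m) (hv₁ : |v₁| ≤ k)
    (hv₂ : |v₂| ≤ k) : u₁ * v₁ - u₂ * v₂ + u₁ * v₂ + u₂ * v₁ ≤ 2 * (m * k) := by
  have hm : 0 ≤ m := (abs_nonneg _).trans hu₁
  have h1 : u₁ * (v₁ + v₂) ≤ m * |v₁ + v₂| :=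
    (le_abs_self _).trans (by rw [abs_mul]; gcongr)
  have h2 : u₂ * (v₁ - v₂) ≤ m * |v₁ - v₂| :=
    (le_abs_self _).trans (by rw [abs_mul]; gcongr)
  have h3 : |v₁ + v₂| + |v₁ - v₂| ≤ 2 * k := by
    rw [abs_le] at hv₁ hv₂
    rcases abs_cases (v₁ + v₂) with h | h <;> rcases abs_cases (v₁ - v₂) with h' | h' <;> linarith
  nlinarith

/-- The coefficients of the Svetlichny expression. -/
def svetSign {N : ℕ} (x : Fin N → Fin 2) : ℝ := (phase x).re + (phase x).im

lemma svetSign_sq {N : ℕ} (x : Fin N → Fin 2) : svetSign x ^ 2 = 1 := by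
  obtain ⟨h1, h2⟩ := phase_re_im x
  rw [svetSign]
  linear_combination h2 + 2 * h1

lemma phase_glue {N : ℕ} (b : Finset (Fin N)) (y : b → Fin 2)
    (z : (bᶜ : Finset (Fin N)) → Fin 2) : phase (glue b y z) = phase y * phase z := by
  simp_rw [phase, prod_split b, glue_mem, glue_compl]

lemma paritySign_glue {N : ℕ} (b : Finset (Fin N)) (y : b → Fin 2)
    (z : (bᶜ : Finset (Fin N)) → Fin 2) :
    paritySign (glue b y z) = paritySign y * paritySign z := by
  simp_rw [paritySign, prod_split b, glue_mem, glue_compl]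

/-- The Svetlichny expression is at most `2^(N-1)` on products across a bipartition. -/
lemma svetlichny_product_le {N : ℕ} {b : Finset (Fin N)} (hb : b ∈ bipartitions N)
    {P : (b → Fin 2) → (b → Fin 2) → ℝ}
    {Q : ((bᶜ : Finset (Fin N)) → Fin 2) → ((bᶜ : Finset (Fin N)) → Fin 2) → ℝ}
    (hP : IsResponse P) (hQ : IsResponse Q) :
    ∑ x : Fin N → Fin 2, ∑ a : Fin N → Fin 2, svetSign x * paritySign a *
      (P (fun n => x n) (fun n => a n) * Q (fun n => x n) (fun n => a n)) ≤ 2 ^ N / 2 := by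
  obtain ⟨hb1, hb2⟩ := (Finset.mem_filter.1 hb).2
  have : Nonempty b := hb1.to_subtype
  have : Nonempty (bᶜ : Finset (Fin N)) := hb2.to_subtype
  have h1 (x : Fin N → Fin 2) : ∑ a : Fin N → Fin 2, svetSign x * paritySign a *
      (P (fun n => x n) (fun n => a n) * Q (fun n => x n) (fun n => a n)) =
      svetSign x * (parityMean P (fun n => x n) * parityMean Q (fun n => x n)) := by
    rw [sum_glue b, parityMean, parityMean, Finset.sum_mul_sum, Finset.mul_sum]
    refine Finset.sum_congr rfl fun a _ => ?_
    rw [Finset.mul_sum]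
    refine Finset.sum_congr rfl fun a' _ => ?_
    simp only [paritySign_glue, glue_mem, glue_compl]
    ring
  simp_rw [h1]
  rw [sum_glue b]
  simp_rw [glue_mem, glue_compl, svetSign, phase_glue, Complex.mul_re, Complex.mul_im]
  -- Multiplicativity of the phase turns `Re + Im` of the total phase into a CHSH combination of
  -- four block averages, each bounded by half the number of inputs of its block.
  have h2 : ∑ y, ∑ z, (((phase y).re * (phase z).re - (phase y).im * (phase z).im) +
      ((phase y).re * (phase z).im + (phase y).im * (phase z).re)) *
        (parityMean P y * parityMean Q z) =
      (∑ y, parityMean P y * (phase y).re) * (∑ z, parityMean Q z * (phase z).re) -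
      (∑ y, parityMean P y * (phase y).im) * (∑ z, parityMean Q z * (phase z).im) +
      (∑ y, parityMean P y * (phase y).re) * (∑ z, parityMean Q z * (phase z).im) +
      (∑ y, parityMean P y * (phase y).im) * (∑ z, parityMean Q z * (phase z).re) := by
    simp_rw [Finset.sum_mul_sum, ← Finset.sum_sub_distrib, ← Finset.sum_add_distrib]
    refine Finset.sum_congr rfl fun y _ => Finset.sum_congr rfl fun z _ => ?_
    ring
  rw [h2]
  refine (chsh_bound
    ((abs_sum_mul_le _ _ (abs_parityMean_le hP)).trans sum_abs_re_phase.le)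
    ((abs_sum_mul_le _ _ (abs_parityMean_le hP)).trans sum_abs_im_phase.le)
    ((abs_sum_mul_le _ _ (abs_parityMean_le hQ)).trans sum_abs_re_phase.le)
    ((abs_sum_mul_le _ _ (abs_parityMean_le hQ)).trans sum_abs_im_phase.le)).trans (le_of_eq ?_)
  have hc : Fintype.card b + Fintype.card (bᶜ : Finset (Fin N)) = N := by
    simp only [Fintype.card_coe]
    simp
  calc (2 : ℝ) * (2 ^ Fintype.card b / 2 * (2 ^ Fintype.card (bᶜ : Finset (Fin N)) / 2))
      = 2 ^ (Fintype.card b + Fintype.card (bᶜ : Finset (Fin N))) / 2 := by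
        rw [pow_add]; ring
    _ = 2 ^ N / 2 := by rw [hc]

lemma IsResponse.le_one {I O : Type} [Fintype O] {P : I → O → ℝ} (hP : IsResponse P) (i : I)
    (o : O) : P i o ≤ 1 := by
  rw [← (hP i).2]
  exact Finset.single_le_sum (f := P i) (fun o _ => (hP i).1 o) (Finset.mem_univ o)

/-- The Svetlichny inequality for subnormalised bilocal correlations, the weight `r` of a hidden
variable being the probability of an event it determines. -/
theorem svetlichny_le {N : ℕ} {p : (Fin N → Fin 2) → (Fin N → Fin 2) → ℝ}
    {L : Type} [MeasurableSpace L] {w : Finset (Fin N) → ℝ} {μ : Finset (Fin N) → Measure L}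
    {r : Finset (Fin N) → L → ℝ}
    {P : (b : Finset (Fin N)) → L → (b → Fin 2) → (b → Fin 2) → ℝ}
    {Q : (b : Finset (Fin N)) → L →
      ((bᶜ : Finset (Fin N)) → Fin 2) → ((bᶜ : Finset (Fin N)) → Fin 2) → ℝ}
    (hw : ∀ b ∈ bipartitions N, 0 ≤ w b)
    (hμ : ∀ b ∈ bipartitions N, IsProbabilityMeasure (μ b))
    (hr : ∀ b ∈ bipartitions N, ∀ l, 0 ≤ r b l ∧ r b l ≤ 1)
    (hrm : ∀ b ∈ bipartitions N, Measurable (r b))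
    (hPQ : ∀ b ∈ bipartitions N, ∀ l, IsResponse (P b l) ∧ IsResponse (Q b l))
    (hPm : ∀ b ∈ bipartitions N, ∀ x a, Measurable fun l => P b l x a)
    (hQm : ∀ b ∈ bipartitions N, ∀ x a, Measurable fun l => Q b l x a)
    (hp : ∀ x a, p x a = ∑ b ∈ bipartitions N, w b *
      ∫ l, r b l * (P b l (fun n => x n) (fun n => a n) * Q b l (fun n => x n) (fun n => a n))
        ∂(μ b)) (x₀ : Fin N → Fin 2) :
    ∑ x, ∑ a, svetSign x * paritySign a * p x a ≤ 2 ^ N / 2 * ∑ a, p x₀ a := by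
  have hint : ∀ b ∈ bipartitions N, ∀ x a : Fin N → Fin 2, Integrable
      (fun l => r b l * (P b l (fun n => x n) (fun n => a n) *
        Q b l (fun n => x n) (fun n => a n))) (μ b) := by
    intro b hb x a
    have := hμ b hb
    refine Integrable.of_bound (C := 1)
      ((hrm b hb).mul ((hPm b hb _ _).mul (hQm b hb _ _))).aestronglyMeasurable
      (Filter.Eventually.of_forall fun l => ?_)
    have h1 := hr b hb l
    have h2 := ((hPQ b hb l).1 fun n => x n).1 fun n => a n
    have h3 := ((hPQ b hb l).2 fun n => x n).1 fun n => a n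
    have h4 := (hPQ b hb l).1.le_one (fun n => x n) fun n => a n
    have h5 := (hPQ b hb l).2.le_one (fun n => x n) fun n => a n
    rw [Real.norm_of_nonneg (mul_nonneg h1.1 (mul_nonneg h2 h3))]
    exact mul_le_one₀ h1.2 (mul_nonneg h2 h3) (mul_le_one₀ h4 h3 h5)
  have hint' : ∀ b ∈ bipartitions N, ∀ x a : Fin N → Fin 2, Integrable
      (fun l => r b l * (svetSign x * paritySign a * (P b l (fun n => x n) (fun n => a n) *
        Q b l (fun n => x n) (fun n => a n)))) (μ b) := fun b hb x a =>
    ((hint b hb x a).const_mul (svetSign x * paritySign a)).congr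
      (Filter.Eventually.of_forall fun l => by ring)
  -- The responses are normalised, so the total mass is the average of `r` whatever input `x₀` is
  -- used; it rescales the Svetlichny bound.
  have hsum : ∑ a, p x₀ a = ∑ b ∈ bipartitions N, w b * ∫ l, r b l ∂(μ b) := by
    simp_rw [hp]
    rw [Finset.sum_comm]
    refine Finset.sum_congr rfl fun b hb => ?_
    rw [← Finset.mul_sum, ← integral_finsetSum _ fun a _ => hint b hb x₀ a]
    congr 1
    refine integral_congr_ae (Filter.Eventually.of_forall fun l => ?_)
    simp only
    rw [← Finset.mul_sum, sum_glue b]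
    simp_rw [glue_mem, glue_compl]
    rw [← Finset.sum_mul_sum, ((hPQ b hb l).1 _).2, ((hPQ b hb l).2 _).2]
    ring
  have hlhs : ∑ x, ∑ a, svetSign x * paritySign a * p x a =
      ∑ b ∈ bipartitions N, w b * ∫ l, r b l * ∑ x : Fin N → Fin 2, ∑ a : Fin N → Fin 2,
        svetSign x * paritySign a *
          (P b l (fun n => x n) (fun n => a n) * Q b l (fun n => x n) (fun n => a n))
            ∂(μ b) := by
    simp_rw [hp, Finset.mul_sum]
    simp_rw [Finset.sum_comm (s := Finset.univ) (t := bipartitions N)]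
    refine Finset.sum_congr rfl fun b hb => ?_
    rw [integral_finsetSum _ fun x _ => integrable_finsetSum _ fun a _ => hint' b hb x a,
      Finset.mul_sum]
    refine Finset.sum_congr rfl fun x _ => ?_
    rw [integral_finsetSum _ fun a _ => hint' b hb x a, Finset.mul_sum]
    refine Finset.sum_congr rfl fun a _ => ?_
    rw [mul_left_comm, ← integral_const_mul]
    congr 1
    exact integral_congr_ae (Filter.Eventually.of_forall fun l => by ring)
  rw [hlhs, hsum, Finset.mul_sum]
  refine Finset.sum_le_sum fun b hb => ?_
  have := hμ b hb
  rw [mul_left_comm (2 ^ N / 2), ← integral_const_mul (2 ^ N / 2)]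
  refine mul_le_mul_of_nonneg_left (integral_mono ?_ ?_ fun l => ?_) (hw b hb)
  · simp_rw [Finset.mul_sum]
    exact integrable_finsetSum _ fun x _ => integrable_finsetSum _ fun a _ => hint' b hb x a
  · refine Integrable.const_mul (Integrable.of_bound (C := 1) (hrm b hb).aestronglyMeasurable
      (Filter.Eventually.of_forall fun l => ?_)) _
    rw [Real.norm_of_nonneg (hr b hb l).1]
    exact (hr b hb l).2
  · simp only
    rw [mul_comm]
    exact mul_le_mul_of_nonneg_right
      (svetlichny_product_le hb (hPQ b hb l).1 (hPQ b hb l).2) (hr b hb l).1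

/-! ### Violation of the Svetlichny inequality -/

/-- A qutrit observable with eigenvalues `±1` which is `u |1⟩⟨0| + ū |0⟩⟨1|` on the qubit. -/
def phaseObs (u : ℂ) : Matrix (Fin 3) (Fin 3) ℂ := !![0, star u, 0; u, 0, 0; 0, 0, 1]

lemma phaseObs_conjTranspose (u : ℂ) : (phaseObs u)ᴴ = phaseObs u := by
  ext i j
  fin_cases i <;> fin_cases j <;> simp [phaseObs]

lemma phaseObs_mul_self {u : ℂ} (hu : star u * u = 1) : phaseObs u * phaseObs u = 1 := by
  have hu' : u * star u = 1 := by rw [mul_comm, hu]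
  simp only [RCLike.star_def] at hu hu'
  ext i j
  fin_cases i <;> fin_cases j <;> simp [phaseObs, Matrix.mul_apply, Fin.sum_univ_three, hu, hu']

/-- For a Hermitian involution `O`, the operator `(1 + O) / 2` is a Hermitian idempotent, hence of
the form `Bᴴ B`. -/
lemma half_one_add_posSemidef {d : ℕ} {O : Matrix (Fin d) (Fin d) ℂ} (h1 : Oᴴ = O)
    (h2 : O * O = 1) : ((1 / 2 : ℂ) • (1 + O)).PosSemidef := by
  have h : (1 / 2 : ℂ) • (1 + O) = ((1 / 2 : ℂ) • (1 + O))ᴴ * ((1 / 2 : ℂ) • (1 + O)) := by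
    have h3 : (1 + O) * (1 + O) = (2 : ℂ) • (1 + O) := by
      rw [mul_add, add_mul, add_mul, h2, two_smul]
      simp only [one_mul, mul_one]
      abel
    rw [conjTranspose_smul, conjTranspose_add, conjTranspose_one, h1, smul_mul_smul_comm, h3,
      smul_smul]
    norm_num
  rw [h]
  exact posSemidef_conjTranspose_mul_self _

/-- The phase `i^x` of the observable for the input `x`, shifted by `-π/4` at the first party. -/
def svetPhase {N : ℕ} (n : Fin N) (x : Fin 2) : ℂ :=
  (if n.val = 0 then (1 - Complex.I) / (Real.sqrt 2 : ℝ) else 1) * ![1, Complex.I] x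

lemma sqrt_two_mul_self : ((Real.sqrt 2 : ℝ) : ℂ) * (Real.sqrt 2 : ℝ) = 2 := by
  exact_mod_cast Real.mul_self_sqrt (by norm_num : (0 : ℝ) ≤ 2)

lemma star_svetPhase_mul_self {N : ℕ} (n : Fin N) (x : Fin 2) :
    star (svetPhase n x) * svetPhase n x = 1 := by
  have h1 : star (![1, Complex.I] x) * ![1, Complex.I] x = 1 := by fin_cases x <;> simp
  have h2 : star ((1 - Complex.I) / ((Real.sqrt 2 : ℝ) : ℂ)) *
      ((1 - Complex.I) / ((Real.sqrt 2 : ℝ) : ℂ)) = 1 := by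
    have h0 : ((Real.sqrt 2 : ℝ) : ℂ) ≠ 0 := by simp
    simp only [star_div₀, star_sub, star_one, RCLike.star_def, Complex.conj_I,
      Complex.conj_ofReal]
    field_simp
    rw [pow_two, sqrt_two_mul_self]
    linear_combination -Complex.I_sq
  rw [svetPhase]
  split_ifs
  · rw [star_mul]
    linear_combination h1 + (star (![1, Complex.I] x) * ![1, Complex.I] x) * h2
  · simpa using h1

/-- The purpose of the `-π/4` shift: `Re((1 - i) z) = Re z + Im z`, so every correlator has the sign
of its Svetlichny coefficient and the same modulus. -/
lemma prod_svetPhase {N : ℕ} (hN : N ≠ 0) (x : Fin N → Fin 2) :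
    (∏ n, svetPhase n (x n)).re = svetSign x / Real.sqrt 2 := by
  have h : ∏ n : Fin N, (if n.val = 0 then (1 - Complex.I) / ((Real.sqrt 2 : ℝ) : ℂ) else 1) =
      (1 - Complex.I) / ((Real.sqrt 2 : ℝ) : ℂ) := by
    rw [Finset.prod_eq_single ⟨0, Nat.pos_of_ne_zero hN⟩]
    · simp
    · intro n _ hn
      rw [if_neg fun h => hn (Fin.ext h)]
    · simp
  simp_rw [svetPhase, Finset.prod_mul_distrib, h]
  rw [div_mul_eq_mul_div, Complex.div_ofReal_re, svetSign, phase]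
  simp

/-- The two-outcome measurements of the Svetlichny test. -/
def svetMeas {N : ℕ} (n : Fin N) (x a : Fin 2) : Matrix (Fin 3) (Fin 3) ℂ :=
  (1 / 2 : ℂ) • (1 + (![1, -1] a : ℂ) • phaseObs (svetPhase n x))

lemma svetMeas_isPOVM {N : ℕ} (n : Fin N) : IsPOVM (svetMeas n) := by
  intro x
  have h1 := phaseObs_conjTranspose (svetPhase n x)
  have h2 := phaseObs_mul_self (star_svetPhase_mul_self n x)
  constructor
  · intro a
    refine half_one_add_posSemidef ?_ ?_
    · fin_cases a <;> simp [h1]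
    · fin_cases a <;> simp [h2]
  · simp only [svetMeas, Fin.sum_univ_two, cons_val_zero, cons_val_one, one_smul, neg_smul,
      ← smul_add]
    have : (1 + phaseObs (svetPhase n x)) + (1 + -phaseObs (svetPhase n x)) =
      (2 : ℂ) • (1 : Matrix (Fin 3) (Fin 3) ℂ) := by
      rw [two_smul]; abel
    rw [this, smul_smul]
    norm_num

/-- The observables have no diagonal on the qubit, so only the GHZ coherences `s ≠ t` enter the
correlators. -/
lemma sum_sign_filtFun {N : ℕ} (α : ℝ) (s t : Fin 2) (n : Fin N) (x : Fin 2) :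
    ∑ k, (![1, -1] k : ℂ) * filtFun α s t (svetMeas n x k) =
      !![0, α * svetPhase n x; α * star (svetPhase n x), 0] s t := by
  fin_cases s <;> fin_cases t <;> simp [filtFun, svetMeas, phaseObs] <;> ring

lemma sum_filtFun {N : ℕ} (α : ℝ) (s t : Fin 2) (n : Fin N) (x : Fin 2) :
    ∑ k, (1 : ℂ) * filtFun α s t (svetMeas n x k) = if s = t then 1 else 0 := by
  fin_cases s <;> fin_cases t <;> simp [filtFun, svetMeas, phaseObs] <;> ring

lemma sum_weight_mul_prod {N : ℕ} (g : Fin 2 → ℂ) (f : Fin 2 → Fin 2 → Fin N → Fin 2 → ℂ) :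
    ∑ a : Fin N → Fin 2, (∏ n, g (a n)) * ∑ s, ∑ t, ∏ n, f s t n (a n) =
      ∑ s, ∑ t, ∏ n, ∑ k, g k * f s t n k := by
  simp_rw [Finset.prod_univ_sum, Fintype.piFinset_univ, Finset.prod_mul_distrib, Finset.mul_sum]
  rw [Finset.sum_comm]
  exact Finset.sum_congr rfl fun s _ => Finset.sum_comm

/-- Correlations proportional to those of the filtered state violate the Svetlichny inequality. -/
lemma svetlichny_violation {N : ℕ} (hN : N ≠ 0) {α w : ℝ} (hα : 3 / 4 ≤ α ^ N) (hw : 0 < w)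
    {p : (Fin N → Fin 2) → (Fin N → Fin 2) → ℝ}
    (hp : ∀ x a, p x a =
      ((w : ℂ) * ∑ s, ∑ t, ∏ n, filtFun α s t (svetMeas n (x n) (a n))).re)
    (x₀ : Fin N → Fin 2) :
    2 ^ N / 2 * ∑ a, p x₀ a < ∑ x, ∑ a, svetSign x * paritySign a * p x a := by
  have h1 : ∑ a, p x₀ a = 2 * w := by
    have h := sum_weight_mul_prod (N := N) (fun _ => 1)
      (fun s t n k => filtFun α s t (svetMeas n (x₀ n) k))
    simp_rw [sum_filtFun] at h
    simp only [Finset.prod_const_one, one_mul] at h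
    simp_rw [hp, ← Complex.re_sum, ← Finset.mul_sum]
    rw [h]
    simp [hN]
    ring
  have h2 (x : Fin N → Fin 2) : ∑ a, svetSign x * paritySign a * p x a =
      2 * w * α ^ N / Real.sqrt 2 := by
    have h := sum_weight_mul_prod (N := N) (fun k => ![1, -1] k)
      (fun s t n k => filtFun α s t (svetMeas n (x n) k))
    simp_rw [sum_sign_filtFun] at h
    have h3 : ∑ a, paritySign a * p x a = (∑ a : Fin N → Fin 2, (w : ℂ) *
        ((∏ n, ![1, -1] (a n)) * ∑ s, ∑ t, ∏ n, filtFun α s t (svetMeas n (x n) (a n)))).re := by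
      rw [Complex.re_sum]
      refine Finset.sum_congr rfl fun a _ => ?_
      have : (∏ n, (![1, -1] (a n) : ℂ)) = ((paritySign a : ℝ) : ℂ) := by
        rw [paritySign]
        push_cast
        refine Finset.prod_congr rfl fun n _ => ?_
        generalize a n = k
        fin_cases k <;> simp
      rw [this, hp, mul_left_comm (w : ℂ), Complex.re_ofReal_mul (paritySign a)]
    rw [← Finset.mul_sum, h] at h3
    have h4 : ∏ n, star (svetPhase n (x n)) = star (∏ n, svetPhase n (x n)) := by
      rw [star_prod]
    have h5 : (∑ s : Fin 2, ∑ t : Fin 2, ∏ n,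
        (!![0, α * svetPhase n (x n); α * star (svetPhase n (x n)), 0] s t : ℂ)).re =
        2 * α ^ N * (svetSign x / Real.sqrt 2) := by
      rw [← prod_svetPhase hN]
      simp only [Fin.sum_univ_two, of_apply, cons_val_zero, cons_val_one, Finset.prod_mul_distrib,
        h4, Finset.prod_const, Finset.card_univ, Fintype.card_fin, zero_pow hN]
      simp only [zero_add, add_zero, Complex.add_re, ← Complex.ofReal_pow, Complex.re_ofReal_mul,
        RCLike.star_def, Complex.conj_re]
      ring
    rw [Complex.re_ofReal_mul, h5] at h3
    simp_rw [mul_assoc, ← Finset.mul_sum]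
    rw [h3]
    have := svetSign_sq x
    calc svetSign x * (w * (2 * α ^ N * (svetSign x / √2)))
        = svetSign x ^ 2 * (2 * (w * (α ^ N / √2))) := by ring
      _ = _ := by rw [this]; ring
  rw [h1]
  simp_rw [h2]
  simp only [Finset.sum_const, Finset.card_univ, Fintype.card_fun, Fintype.card_fin, nsmul_eq_mul]
  push_cast
  -- The ratio of the Svetlichny value to the bound is `√2 α ^ N`; with `α ^ N ≥ 3/4` it exceeds `1`
  -- because `√2 < 3/2`.
  have h3 : Real.sqrt 2 < 3 / 2 := by
    rw [Real.sqrt_lt' (by norm_num)]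
    norm_num
  have h4 : 0 < Real.sqrt 2 := by positivity
  have h5 : 1 < 2 * α ^ N / Real.sqrt 2 := by
    rw [lt_div_iff₀ h4]
    linarith
  have h6 : (0 : ℝ) < 2 ^ N * w := by positivity
  calc 2 ^ N / 2 * (2 * w) = 2 ^ N * w * 1 := by ring
    _ < 2 ^ N * w * (2 * α ^ N / √2) := mul_lt_mul_of_pos_left h5 h6
    _ = _ := by ring

theorem filtered_isGMNL {N : ℕ} (hN : N ≠ 0) {α θ : ℝ} (hα : α ∈ Set.Icc (0 : ℝ) 1)
    (hα' : 3 / 4 ≤ α ^ N) (hc : Real.cos θ ≠ 0) (hs : Real.sin θ ≠ 0) :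
    IsGMNL (filtered (Real.tan θ) (rhoGME N α θ)) := by
  refine ⟨2, 2, svetMeas, svetMeas_isPOVM, ?_⟩
  rintro ⟨L, _, w, μ, P, Q, hw, -, hμ, hPQ, hPm, hQm, hp⟩
  refine (svetlichny_violation hN hα' (w := 1 / 2) (by norm_num) (fun x a => ?_) 0).not_ge
    (svetlichny_le (r := fun _ _ => 1) hw hμ (fun _ _ _ => by simp) (fun _ _ => measurable_const)
      hPQ hPm hQm (by simpa only [one_mul] using hp) 0)
  rw [born, trace_filtered_mul_tensor hN hα hc hs]
  simp

/-- Condition on every party obtaining the filter outcome. In a time-ordered model the probability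
of that event, given the hidden variable, cannot depend on the later inputs. The conditioned
statistics are therefore a subnormalised bilocal model, yet they are proportional to those of the
filtered state. -/
theorem rhoGME_isSeqGMNL {N : ℕ} (hN : N ≠ 0) {α θ : ℝ} (hα : α ∈ Set.Icc (0 : ℝ) 1)
    (hα' : 3 / 4 ≤ α ^ N) (hc : Real.cos θ ≠ 0) (hs : Real.sin θ ≠ 0)
    (ht : Real.tan θ ^ 2 ≤ 1) : IsSeqGMNL (rhoGME N α θ) := by
  -- One first input with two outcomes: the filter and its completion `√(1 - G²)`, which exists
  -- because `tan θ ≤ 1`.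
  refine ⟨1, 2, 2, 2, fun _ _ => ![filterOp (Real.tan θ),
    diagonal ![((Real.sqrt (1 - Real.tan θ ^ 2) : ℝ) : ℂ), 0, 1]], svetMeas, ?_,
    svetMeas_isPOVM, ?_⟩
  · intro n z
    simp only [Fin.sum_univ_two, cons_val_zero, cons_val_one, filterOp_conjTranspose,
      diagonal_conjTranspose]
    rw [filterOp, diagonal_mul_diagonal, diagonal_mul_diagonal, diagonal_add, ← diagonal_one]
    congr 1
    ext k
    have : ((Real.sqrt (1 - Real.tan θ ^ 2) : ℝ) : ℂ) * (Real.sqrt (1 - Real.tan θ ^ 2) : ℝ) =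
        1 - ((Real.tan θ : ℝ) : ℂ) ^ 2 := by
      exact_mod_cast Real.mul_self_sqrt (by linarith : (0 : ℝ) ≤ 1 - Real.tan θ ^ 2)
    fin_cases k <;> simp [this, -Complex.ofReal_tan]
    ring
  · rintro ⟨L, _, w, μ, P₁, P₂, Q₁, Q₂, hw, -, hμ, hPQ, hP₂, hQ₂, hP₁m, hP₂m, hQ₁m, hQ₂m, hp⟩
    refine (svetlichny_violation hN hα' (filterWeight_pos (N := N) hα hc hs)
      (fun x a => ?_) 0).not_ge
      -- The weight `r` is the probability that both blocks report success of all their filters;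
      -- outcome `0` is success.
      (svetlichny_le (r := fun b l => P₁ b l 0 0 * Q₁ b l 0 0) hw hμ (fun b hb l => ?_)
        (fun b hb => (hP₁m b hb 0 0).mul (hQ₁m b hb 0 0))
        (fun b hb l => ⟨hP₂ b hb l 0 0, hQ₂ b hb l 0 0⟩)
        (fun b hb => hP₂m b hb 0 0) (fun b hb => hQ₂m b hb 0 0)
        (fun x a => (hp 0 0 x a).trans ?_) 0)
    · rw [seqBorn, ← trace_filterAll_rhoGME_mul_tensor hN α hc, filterAll]
      simp [tensor_filterOp_conjTranspose]
    · have h1 := (hPQ b hb l).1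
      have h2 := (hPQ b hb l).2
      exact ⟨mul_nonneg ((h1 0).1 0) ((h2 0).1 0),
        mul_le_one₀ (h1.le_one 0 0) ((h2 0).1 0) (h2.le_one 0 0)⟩
    · refine Finset.sum_congr rfl fun b _ => ?_
      congr 1
      refine integral_congr_ae (Filter.Eventually.of_forall fun l => ?_)
      exact mul_mul_mul_comm _ _ _ _

/-! ### Genuine multipartite entanglement -/

/-- The diagonal of `G_ε^{⊗N}`. -/
def filterCoeff {N : ℕ} (ε : ℝ) (i : Fin N → Fin 3) : ℝ := ∏ n, ![ε, 1, 0] (i n)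

lemma filterAll_apply {N : ℕ} (ε : ℝ) (ρ : MultiOp N 3) (i j : Fin N → Fin 3) :
    filterAll ε ρ i j = (filterCoeff ε i : ℂ) * ρ i j * (filterCoeff ε j : ℂ) := by
  have h : (tensor fun _ : Fin N => filterOp ε) =
      diagonal fun i => ((filterCoeff ε i : ℝ) : ℂ) := by
    ext i j
    simp_rw [tensor, of_apply, filterOp, diagonal_apply, Finset.prod_ite_zero, Finset.mem_univ,
      forall_const, ← funext_iff, filterCoeff]
    push_cast
    congr 1
    refine Finset.prod_congr rfl fun n _ => ?_
    generalize i n = k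
    fin_cases k <;> simp
  rw [filterAll, h, mul_diagonal, diagonal_mul]

/-- A witness of genuine multipartite entanglement, evaluated after filtering. -/
def witness (N : ℕ) (ε : ℝ) : MultiOp N 3 →ₗ[ℝ] ℝ where
  toFun ρ := ∑ i ∈ ({fun _ => 0, fun _ => 1} : Finset (Fin N → Fin 3))ᶜ, (filterAll ε ρ i i).re -
    2 * (filterAll ε ρ (fun _ => 0) (fun _ => 1)).re
  map_add' ρ σ := by
    simp only [filterAll_apply, Matrix.add_apply, mul_add, add_mul, Complex.add_re,
      Finset.sum_add_distrib]
    ring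
  map_smul' c ρ := by
    simp only [filterAll_apply, Matrix.smul_apply, Complex.real_smul, mul_left_comm _ (c : ℂ),
      mul_assoc, Complex.re_ofReal_mul, ← Finset.mul_sum, RingHom.id_apply, smul_eq_mul]
    ring

/-- For a product vector, exchanging the values of the two blocks preserves the product of
amplitudes: `|χ(0⋯0) χ(1⋯1)| = |χ(0_b 1_{bᶜ}) χ(1_b 0_{bᶜ})|`. The filter is a product and respects
this. By AM-GM the coherence is then dominated by two diagonal entries other than the GHZ ones. -/
lemma witness_ketbra_nonneg {N : ℕ} (ε : ℝ) {b : Finset (Fin N)} (hb : b ∈ bipartitions N)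
    (Φ : (b → Fin 3) → ℂ) (Ψ : ((bᶜ : Finset (Fin N)) → Fin 3) → ℂ) :
    0 ≤ witness N ε (ketbra (bipartiteVec b Φ Ψ)) := by
  obtain ⟨⟨n₁, h₁⟩, ⟨n₂, h₂⟩⟩ := (Finset.mem_filter.1 hb).2
  rw [Finset.mem_compl] at h₂
  set χ := bipartiteVec b Φ Ψ with hχ
  set g : (Fin N → Fin 3) → ℝ := filterCoeff ε with hg
  let c (k l : Fin 3) : Fin N → Fin 3 := glue b (fun _ => k) (fun _ => l)
  have hc (k : Fin 3) : c k k = fun _ => k := by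
    ext n
    simp [c, glue]
  have hmem (k l : Fin 3) (hkl : k ≠ l) :
      c k l ∈ ({fun _ => 0, fun _ => 1} : Finset (Fin N → Fin 3))ᶜ := by
    have e1 : c k l n₁ = k := by simp [c, glue, h₁]
    have e2 : c k l n₂ = l := by simp [c, glue, h₂]
    simp only [Finset.mem_compl, Finset.mem_insert, Finset.mem_singleton, not_or]
    constructor <;> intro h <;> rw [h] at e1 e2 <;> exact hkl (e1.symm.trans e2)
  have hne : c 0 1 ≠ c 1 0 := by
    intro h
    have := congrFun h n₁
    simp [c, glue, h₁] at this
  have hdiag (i : Fin N → Fin 3) : (filterAll ε (ketbra χ) i i).re = (g i * ‖χ i‖) ^ 2 := by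
    rw [filterAll_apply, ketbra, vecMulVec_apply, Pi.star_apply, RCLike.star_def,
      Complex.mul_conj, Complex.normSq_eq_norm_sq]
    norm_cast
    ring
  have hχc (k l : Fin 3) : χ (c k l) = Φ (fun _ => k) * Ψ (fun _ => l) := by
    simp only [hχ, bipartiteVec, c, glue_mem, glue_compl]
  have hgc (k l : Fin 3) : g (c k l) = (∏ n : b, ![ε, 1, 0] k) *
      ∏ n : (bᶜ : Finset (Fin N)), ![ε, 1, 0] l := by
    simp only [hg, filterCoeff, prod_split b, c, glue_mem, glue_compl]
  have hoff : (filterAll ε (ketbra χ) (fun _ => 0) (fun _ => 1)).re ≤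
      |g (c 0 1) * ‖χ (c 0 1)‖ * (g (c 1 0) * ‖χ (c 1 0)‖)| := by
    refine (Complex.re_le_norm _).trans (le_of_eq ?_)
    rw [filterAll_apply, ← hc, ← hc, ketbra, vecMulVec_apply, Pi.star_apply, ← hg]
    simp only [norm_mul, norm_star, hχc, hgc, Complex.norm_real, Real.norm_eq_abs, abs_mul,
      abs_norm, Complex.ofReal_mul]
    ring
  have hsub : ∑ i ∈ {c 0 1, c 1 0}, (g i * ‖χ i‖) ^ 2 ≤
      ∑ i ∈ ({fun _ => 0, fun _ => 1} : Finset (Fin N → Fin 3))ᶜ, (g i * ‖χ i‖) ^ 2 := by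
    refine Finset.sum_le_sum_of_subset_of_nonneg ?_ fun i _ _ => sq_nonneg _
    intro i hi
    rcases Finset.mem_insert.1 hi with rfl | hi
    · exact hmem 0 1 (by decide)
    · rw [Finset.mem_singleton.1 hi]
      exact hmem 1 0 (by decide)
  rw [Finset.sum_pair hne] at hsub
  change 0 ≤ ∑ i ∈ _, (filterAll ε (ketbra χ) i i).re - _
  simp_rw [hdiag]
  have := abs_mul (g (c 0 1) * ‖χ (c 0 1)‖) (g (c 1 0) * ‖χ (c 1 0)‖)
  have h2 := two_mul_le_add_sq |g (c 0 1) * ‖χ (c 0 1)‖| |g (c 1 0) * ‖χ (c 1 0)‖|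
  rw [sq_abs, sq_abs] at h2
  linarith

lemma witness_nonneg {N : ℕ} (ε : ℝ) {ρ : MultiOp N 3} (hρ : IsBiseparable ρ) :
    0 ≤ witness N ε ρ := by
  obtain ⟨k, p, q, Φ, Ψ, hp, -, hq, -, rfl⟩ := hρ
  simp_rw [Complex.coe_smul, map_sum, map_smul]
  refine Finset.sum_nonneg fun b hb => ?_
  rw [map_sum]
  refine smul_nonneg (hp b hb) (Finset.sum_nonneg fun j _ => ?_)
  rw [map_smul]
  exact smul_nonneg ((hq b hb).1 j) (witness_ketbra_nonneg ε hb _ _)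

theorem rhoGME_isGME {N : ℕ} (hN : N ≠ 0) {α θ : ℝ} (hα : α ∈ Set.Icc (0 : ℝ) 1)
    (hα' : 3 / 4 ≤ α ^ N) (hc : Real.cos θ ≠ 0) (hs : Real.sin θ ≠ 0) :
    IsGME (rhoGME N α θ) := by
  refine ⟨⟨rhoGME_posSemidef hα θ, trace_rhoGME hN hα hc hs⟩, fun hsep => ?_⟩
  have h := witness_nonneg (Real.tan θ) hsep
  set σ := filtered (Real.tan θ) (rhoGME N α θ) with hσ
  have hw := filterWeight_pos (N := N) hα hc hs
  have hX (i j) : (filterAll (Real.tan θ) (rhoGME N α θ) i j).re =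
      2 * filterWeight N α θ * (σ i j).re := by
    have h1 : σ i j = ((2 * filterWeight N α θ : ℝ) : ℂ)⁻¹ *
        filterAll (Real.tan θ) (rhoGME N α θ) i j := by
      rw [← trace_filterAll_rhoGME hN α hc]
      rfl
    have h2 : ((2 * filterWeight N α θ : ℝ) : ℂ) ≠ 0 := by
      exact_mod_cast (mul_pos two_pos hw).ne'
    rw [← Complex.re_ofReal_mul, h1, mul_inv_cancel_left₀ h2]
  change 0 ≤ ∑ i ∈ _, (filterAll _ (rhoGME N α θ) i i).re - _ at h
  simp_rw [hX, ← Finset.mul_sum] at h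
  have htr : ∑ i, (σ i i).re = 1 := by
    have := (isState_filtered hN hα hc hs).2
    rw [← Complex.re_sum]
    change (σ.trace).re = 1
    rw [this, Complex.one_re]
  have hne : (fun _ => 0 : Fin N → Fin 3) ≠ fun _ => 1 := by
    intro h
    have := congrFun h ⟨0, Nat.pos_of_ne_zero hN⟩
    simp at this
  rw [← Finset.sum_add_sum_compl {fun _ => 0, fun _ => 1}, Finset.sum_pair hne] at htr
  have h0 := filtered_diag hN hα hc hs 0
  have h1 := filtered_diag hN hα hc hs 1
  simp only [Fin.castSucc_zero, Fin.castSucc_one] at h0 h1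
  rw [← hσ] at h0 h1
  have h2 := filtered_zero_one hN hα hc hs
  rw [← hσ] at h2
  rw [h0, h1] at htr
  rw [h2] at h
  simp only [Complex.ofReal_re] at h htr
  -- After normalisation the witness equals `1 - [((1 + α)/2) ^ N + ((1 - α)/2) ^ N] - α ^ N`, at
  -- most `1 - 2 · 3/4 < 0`.
  have h3 : α ^ N ≤ ((1 + α) / 2) ^ N := pow_le_pow_left₀ hα.1 (by linarith [hα.2]) N
  have h4 : 0 ≤ ((1 - α) / 2) ^ N := pow_nonneg (by linarith [hα.2]) N
  nlinarith

/-! ### Gaussian integrals in the complex plane -/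

lemma integral_complex_radial (f : ℝ → ℝ) :
    ∫ z : ℂ, f ‖z‖ = 2 * Real.pi * ∫ y in Set.Ioi 0, y * f y := by
  rw [integral_fun_norm_addHaar volume f]
  simp [Complex.finrank_real_complex, Complex.volume_ball, Measure.real]
  ring

lemma integral_exp_neg_mul_sq_norm {b : ℝ} (hb : 0 < b) :
    ∫ z : ℂ, Real.exp (-(b * ‖z‖ ^ 2)) = Real.pi / b := by
  have h := Complex.integral_rpow_mul_exp_neg_mul_rpow (p := 2) (q := 0) (b := b) (by norm_num)
    (by norm_num) hb
  simp only [Real.rpow_zero, one_mul, Real.rpow_two, neg_mul] at h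
  rw [h]
  norm_num [Real.rpow_neg_one]
  rfl

lemma integral_sq_norm_mul_exp {b : ℝ} (hb : 0 < b) :
    ∫ z : ℂ, ‖z‖ ^ 2 * Real.exp (-(b * ‖z‖ ^ 2)) = Real.pi / b ^ 2 := by
  have h := Complex.integral_rpow_mul_exp_neg_mul_rpow (p := 2) (q := 2) (b := b) (by norm_num)
    (by norm_num) hb
  simp only [Real.rpow_two, neg_mul] at h
  rw [h]
  norm_num [Real.rpow_neg hb.le]
  rfl

lemma integrable_exp_neg_mul_sq_norm {b : ℝ} (hb : 0 < b) :
    Integrable fun z : ℂ => Real.exp (-(b * ‖z‖ ^ 2)) := by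
  -- A non-integrable function has Bochner integral `0`, contradicting the positive value already
  -- computed.
  by_contra h
  have := integral_undef h
  rw [integral_exp_neg_mul_sq_norm hb] at this
  have : 0 < Real.pi / b := by positivity
  linarith

lemma integrable_sq_norm_mul_exp {b : ℝ} (hb : 0 < b) :
    Integrable fun z : ℂ => ‖z‖ ^ 2 * Real.exp (-(b * ‖z‖ ^ 2)) := by
  by_contra h
  have := integral_undef h
  rw [integral_sq_norm_mul_exp hb] at this
  have : 0 < Real.pi / b ^ 2 := by positivity
  linarith

lemma integral_Ioc_mul_exp_neg_sq {r : ℝ} (hr : 0 ≤ r) :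
    ∫ y in Set.Ioc 0 r, y * Real.exp (-y ^ 2) = (1 - Real.exp (-r ^ 2)) / 2 := by
  rw [← intervalIntegral.integral_of_le hr,
    intervalIntegral.integral_eq_sub_of_hasDerivAt (f := fun y => -Real.exp (-y ^ 2) / 2)]
  · simp; ring
  · intro y _
    refine ((hasDerivAt_pow 2 y).neg.exp.neg.div_const 2).congr_deriv ?_
    simp
    ring
  · exact (by fun_prop : Continuous fun y : ℝ => y * Real.exp (-y ^ 2)).intervalIntegrable _ _

lemma integral_exp_of_le {R : ℝ} (hR : 0 ≤ R) :
    ∫ z : ℂ, (if ‖z‖ ^ 2 ≤ R then Real.exp (-‖z‖ ^ 2) else 0) =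
      Real.pi * (1 - Real.exp (-R)) := by
  rw [integral_complex_radial fun y => if y ^ 2 ≤ R then Real.exp (-y ^ 2) else 0]
  have h : ∫ y in Set.Ioi 0, y * (if y ^ 2 ≤ R then Real.exp (-y ^ 2) else 0) =
      ∫ y in Set.Ioc 0 (Real.sqrt R), y * Real.exp (-y ^ 2) := by
    rw [← integral_indicator measurableSet_Ioi, ← integral_indicator measurableSet_Ioc]
    congr 1
    ext y
    by_cases hy : 0 < y
    · by_cases hy' : y ^ 2 ≤ R
      · simp [Set.indicator, hy, hy', Real.le_sqrt' hy]
      · simp [Set.indicator, hy, hy', Real.le_sqrt' hy]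
    · simp [Set.indicator, hy]
  rw [h, integral_Ioc_mul_exp_neg_sq (Real.sqrt_nonneg _), Real.sq_sqrt hR]
  ring

lemma integral_exp_of_lt {R : ℝ} (hR : 0 ≤ R) :
    ∫ z : ℂ, (if ‖z‖ ^ 2 < R then Real.exp (-‖z‖ ^ 2) else 0) =
      Real.pi * (1 - Real.exp (-R)) := by
  rw [integral_complex_radial fun y => if y ^ 2 < R then Real.exp (-y ^ 2) else 0]
  have h : ∫ y in Set.Ioi 0, y * (if y ^ 2 < R then Real.exp (-y ^ 2) else 0) =
      ∫ y in Set.Ioo 0 (Real.sqrt R), y * Real.exp (-y ^ 2) := by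
    rw [← integral_indicator measurableSet_Ioi, ← integral_indicator measurableSet_Ioo]
    congr 1
    ext y
    by_cases hy : 0 < y
    · by_cases hy' : y ^ 2 < R
      · simp [Set.indicator, hy, hy', Real.lt_sqrt hy.le]
      · simp [Set.indicator, hy, hy', Real.lt_sqrt hy.le]
    · simp [Set.indicator, hy]
  rw [h, ← integral_Ioc_eq_integral_Ioo, integral_Ioc_mul_exp_neg_sq (Real.sqrt_nonneg _),
    Real.sq_sqrt hR]
  ring

lemma integral_exp_of_ge {R : ℝ} (hR : 0 ≤ R) :
    ∫ z : ℂ, (if R ≤ ‖z‖ ^ 2 then Real.exp (-‖z‖ ^ 2) else 0) = Real.pi * Real.exp (-R) := by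
  have h1 := integrable_exp_neg_mul_sq_norm one_pos
  have h2 := integral_exp_neg_mul_sq_norm one_pos
  simp only [one_mul, div_one] at h1 h2
  have h3 : Integrable fun z : ℂ => if ‖z‖ ^ 2 < R then Real.exp (-‖z‖ ^ 2) else 0 :=
    h1.indicator (s := {z : ℂ | ‖z‖ ^ 2 < R}) (measurableSet_lt (by fun_prop) (by fun_prop))
  have h4 : (fun z : ℂ => if R ≤ ‖z‖ ^ 2 then Real.exp (-‖z‖ ^ 2) else 0) = fun z =>
      Real.exp (-‖z‖ ^ 2) - if ‖z‖ ^ 2 < R then Real.exp (-‖z‖ ^ 2) else 0 := by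
    ext z
    by_cases h : R ≤ ‖z‖ ^ 2
    · simp [h, h.not_gt]
    · simp [h, not_le.1 h]
  rw [h4, integral_sub h1 h3, h2, integral_exp_of_lt hR]
  ring

/-! ### Gaussian vectors in `ℂ²` -/

/-- The density of a standard complex Gaussian vector. -/
def gaussWeight (ψ : Fin 2 → ℂ) : ℝ := Real.exp (-(‖ψ 0‖ ^ 2 + ‖ψ 1‖ ^ 2)) / Real.pi ^ 2

/-- The matrix elements of the operator `|ψ⟩⟨ψ|`, weighted by the Gaussian density. -/
def hidden (s t : Fin 2) (ψ : Fin 2 → ℂ) : ℂ := (gaussWeight ψ : ℂ) * (ψ s * star (ψ t))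

/-- The real determinant of a complex linear map is `|det U|²`, here `1`. -/
lemma measurePreserving_unitary (U : unitaryGroup (Fin 2) ℂ) :
    MeasurePreserving (fun ψ : Fin 2 → ℂ => U.1 *ᵥ ψ) volume volume := by
  let f : (Fin 2 → ℂ) →ₗ[ℝ] (Fin 2 → ℂ) := (Matrix.toLin' U.1).restrictScalars ℝ
  have hU : ‖U.1.det‖ = 1 := CStarRing.norm_of_mem_unitary (det_of_mem_unitary U.2)
  have hdet : LinearMap.det f = 1 := by
    rw [LinearMap.det_restrictScalars, LinearMap.det_toLin', Algebra.norm_complex_apply,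
      Complex.normSq_eq_norm_sq, hU, one_pow]
  have hf : Measurable f := f.continuous_of_finiteDimensional.measurable
  refine ⟨hf, ?_⟩
  change Measure.map f volume = volume
  rw [Measure.map_linearMap_addHaar_eq_smul_addHaar volume (by rw [hdet]; exact one_ne_zero), hdet]
  simp

lemma measurableEmbedding_unitary (U : unitaryGroup (Fin 2) ℂ) :
    MeasurableEmbedding (fun ψ : Fin 2 → ℂ => U.1 *ᵥ ψ) := by
  refine Continuous.measurableEmbedding (by fun_prop) fun ψ φ h => ?_
  have h1 : star U.1 * U.1 = 1 := (mem_unitaryGroup_iff').1 U.2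
  have h2 := congrArg (fun χ => star U.1 *ᵥ χ) h
  simpa only [mulVec_mulVec, h1, one_mulVec] using h2

lemma integral_comp_unitary (U : unitaryGroup (Fin 2) ℂ) (F : (Fin 2 → ℂ) → ℂ) :
    ∫ ψ, F (U.1 *ᵥ ψ) = ∫ ψ, F ψ :=
  (measurePreserving_unitary U).integral_comp (measurableEmbedding_unitary U) F

lemma gaussWeight_unitary (U : unitaryGroup (Fin 2) ℂ) (ψ : Fin 2 → ℂ) :
    gaussWeight (U.1 *ᵥ ψ) = gaussWeight ψ := by
  have h1 : star U.1 * U.1 = 1 := (mem_unitaryGroup_iff').1 U.2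
  have h (φ : Fin 2 → ℂ) : star φ ⬝ᵥ φ = ((‖φ 0‖ ^ 2 + ‖φ 1‖ ^ 2 : ℝ) : ℂ) := by
    simp [dotProduct, Fin.sum_univ_two, Complex.conj_mul']
  have h2 : star (U.1 *ᵥ ψ) ⬝ᵥ (U.1 *ᵥ ψ) = star ψ ⬝ᵥ ψ := by
    rw [star_mulVec, ← dotProduct_mulVec, mulVec_mulVec, ← star_eq_conjTranspose, h1, one_mulVec]
  rw [h, h] at h2
  have h3 := Complex.ofReal_injective h2
  simp only [gaussWeight, h3]

lemma integral_finTwo (F : ℂ → ℂ → ℝ) :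
    ∫ ψ : Fin 2 → ℂ, F (ψ 0) (ψ 1) = ∫ q : ℂ × ℂ, F q.1 q.2 :=
  (volume_preserving_finTwoArrow ℂ).integral_comp' (fun q : ℂ × ℂ => F q.1 q.2)

lemma integrable_finTwo {F : ℂ → ℂ → ℝ} (h : Integrable fun q : ℂ × ℂ => F q.1 q.2) :
    Integrable fun ψ : Fin 2 → ℂ => F (ψ 0) (ψ 1) :=
  ((volume_preserving_finTwoArrow ℂ).integrable_comp_emb
    (MeasurableEquiv.measurableEmbedding _)).2 h

lemma integrable_exp : Integrable fun z : ℂ => Real.exp (-‖z‖ ^ 2) := by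
  simpa using integrable_exp_neg_mul_sq_norm one_pos

lemma integrable_sq_exp : Integrable fun z : ℂ => ‖z‖ ^ 2 * Real.exp (-‖z‖ ^ 2) := by
  simpa using integrable_sq_norm_mul_exp one_pos

lemma integrable_gaussWeight_zero :
    Integrable fun ψ : Fin 2 → ℂ => gaussWeight ψ * ‖ψ 0‖ ^ 2 := by
  refine integrable_finTwo (F := fun u v =>
    Real.exp (-(‖u‖ ^ 2 + ‖v‖ ^ 2)) / Real.pi ^ 2 * ‖u‖ ^ 2) ?_
  refine ((integrable_sq_exp.mul_prod integrable_exp).const_mul (1 / Real.pi ^ 2)).congr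
    (Filter.Eventually.of_forall fun q => ?_)
  simp only [neg_add, Real.exp_add]
  ring

lemma integrable_gaussWeight_one :
    Integrable fun ψ : Fin 2 → ℂ => gaussWeight ψ * ‖ψ 1‖ ^ 2 := by
  refine integrable_finTwo (F := fun u v =>
    Real.exp (-(‖u‖ ^ 2 + ‖v‖ ^ 2)) / Real.pi ^ 2 * ‖v‖ ^ 2) ?_
  refine ((integrable_exp.mul_prod integrable_sq_exp).const_mul (1 / Real.pi ^ 2)).congr
    (Filter.Eventually.of_forall fun q => ?_)
  simp only [neg_add, Real.exp_add]
  ring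

lemma gaussWeight_nonneg (ψ : Fin 2 → ℂ) : 0 ≤ gaussWeight ψ := by
  unfold gaussWeight
  positivity

lemma continuous_gaussWeight : Continuous gaussWeight := by
  unfold gaussWeight
  fun_prop

lemma continuous_hidden (s t : Fin 2) : Continuous (hidden s t) := by
  unfold hidden
  have := continuous_gaussWeight
  fun_prop

lemma integrable_hidden (s t : Fin 2) : Integrable (hidden s t) := by
  refine (integrable_gaussWeight_zero.add integrable_gaussWeight_one).mono'
    (continuous_hidden s t).aestronglyMeasurable (Filter.Eventually.of_forall fun ψ => ?_)
  have h : ‖ψ s‖ * ‖ψ t‖ ≤ ‖ψ 0‖ ^ 2 + ‖ψ 1‖ ^ 2 := by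
    fin_cases s <;> fin_cases t <;> simp <;> nlinarith [sq_nonneg (‖ψ 0‖ - ‖ψ 1‖)]
  simp only [hidden, norm_mul, norm_star, Complex.norm_real, Pi.add_apply, ← mul_add,
    Real.norm_of_nonneg (gaussWeight_nonneg ψ)]
  exact mul_le_mul_of_nonneg_left h (gaussWeight_nonneg ψ)

lemma integrable_response_hidden {P : (Fin 2 → ℂ) → ℝ} (hP : Measurable P) {C : ℝ}
    (hC : ∀ ψ, |P ψ| ≤ C) (s t : Fin 2) : Integrable fun ψ => (P ψ : ℂ) * hidden s t ψ :=
  (integrable_hidden s t).bdd_mul (Complex.measurable_ofReal.comp hP).aestronglyMeasurable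
    (Filter.Eventually.of_forall fun ψ => by simpa using hC ψ)

lemma hidden_diag (s : Fin 2) (ψ : Fin 2 → ℂ) :
    hidden s s ψ = ((gaussWeight ψ * ‖ψ s‖ ^ 2 : ℝ) : ℂ) := by
  simp [hidden, Complex.mul_conj']

lemma integral_response_hidden_diag (P : (Fin 2 → ℂ) → ℝ) (s : Fin 2) :
    ∫ ψ, (P ψ : ℂ) * hidden s s ψ = ((∫ ψ, P ψ * (gaussWeight ψ * ‖ψ s‖ ^ 2) : ℝ) : ℂ) := by
  rw [← integral_complex_ofReal]
  simp [hidden_diag]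

/-- Responses symmetric under `ψ₀ ↦ -ψ₀` have diagonal averages. -/
lemma integral_response_hidden_off {P : (Fin 2 → ℂ) → ℝ}
    (hP : ∀ ψ, P ![-ψ 0, ψ 1] = P ψ) {s t : Fin 2} (hst : s ≠ t) :
    ∫ ψ, (P ψ : ℂ) * hidden s t ψ = 0 := by
  have hD : diagonal ![(-1 : ℂ), 1] ∈ unitaryGroup (Fin 2) ℂ := by
    rw [mem_unitaryGroup_iff, star_eq_conjTranspose, diagonal_conjTranspose,
      diagonal_mul_diagonal, ← diagonal_one]
    congr 1
    ext k
    fin_cases k <;> simp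
  have h := integral_comp_unitary ⟨_, hD⟩ (fun ψ => (P ψ : ℂ) * hidden s t ψ)
  have h1 (ψ : Fin 2 → ℂ) : diagonal ![(-1 : ℂ), 1] *ᵥ ψ = ![-ψ 0, ψ 1] := by
    ext k
    fin_cases k <;> simp [mulVec_diagonal]
  have h2 (ψ : Fin 2 → ℂ) : hidden s t ![-ψ 0, ψ 1] = -hidden s t ψ := by
    fin_cases s <;> fin_cases t <;> simp [hidden, gaussWeight] at hst ⊢
  simp only [h1, hP, h2, mul_neg, integral_neg] at h
  exact self_eq_neg.1 h.symm

lemma integral_hidden (s t : Fin 2) : ∫ ψ, hidden s t ψ = if s = t then 1 else 0 := by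
  split_ifs with h
  · subst h
    have h1 := integral_response_hidden_diag (fun _ => 1) s
    simp only [Complex.ofReal_one, one_mul] at h1
    rw [h1]
    have e1 := integral_exp_neg_mul_sq_norm one_pos
    have e2 := integral_sq_norm_mul_exp one_pos
    simp only [one_mul, div_one, one_pow] at e1 e2
    norm_cast
    have hpi := Real.pi_ne_zero
    fin_cases s
    · refine (integral_finTwo fun u v =>
        Real.exp (-(‖u‖ ^ 2 + ‖v‖ ^ 2)) / Real.pi ^ 2 * ‖u‖ ^ 2).trans ?_
      have : (fun q : ℂ × ℂ => Real.exp (-(‖q.1‖ ^ 2 + ‖q.2‖ ^ 2)) / Real.pi ^ 2 * ‖q.1‖ ^ 2) =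
          fun q => (‖q.1‖ ^ 2 * Real.exp (-‖q.1‖ ^ 2)) *
            (Real.exp (-‖q.2‖ ^ 2) * (1 / Real.pi ^ 2)) := by
        ext q
        rw [neg_add, Real.exp_add]
        ring
      rw [this, Measure.volume_eq_prod, integral_prod_mul (μ := volume) (ν := volume)
        (fun z : ℂ => ‖z‖ ^ 2 * Real.exp (-‖z‖ ^ 2))
        (fun z : ℂ => Real.exp (-‖z‖ ^ 2) * (1 / Real.pi ^ 2)), integral_mul_const, e1, e2]
      field_simp
    · refine (integral_finTwo fun u v =>
        Real.exp (-(‖u‖ ^ 2 + ‖v‖ ^ 2)) / Real.pi ^ 2 * ‖v‖ ^ 2).trans ?_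
      have : (fun q : ℂ × ℂ => Real.exp (-(‖q.1‖ ^ 2 + ‖q.2‖ ^ 2)) / Real.pi ^ 2 * ‖q.2‖ ^ 2) =
          fun q => (Real.exp (-‖q.1‖ ^ 2) * (1 / Real.pi ^ 2)) *
            (‖q.2‖ ^ 2 * Real.exp (-‖q.2‖ ^ 2)) := by
        ext q
        rw [neg_add, Real.exp_add]
        ring
      rw [this, Measure.volume_eq_prod, integral_prod_mul (μ := volume) (ν := volume)
        (fun z : ℂ => Real.exp (-‖z‖ ^ 2) * (1 / Real.pi ^ 2))
        (fun z : ℂ => ‖z‖ ^ 2 * Real.exp (-‖z‖ ^ 2)), integral_mul_const, e1, e2]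
      field_simp
  · have h1 := integral_response_hidden_off (P := fun _ => 1) (fun _ => rfl) h
    simpa using h1

/-! ### Averages of Gaussian hidden states over spherical caps. -/

/-- The indicator of the cap `|ψ₁|² ≤ κ |ψ₀|²` of the Bloch sphere. -/
def cap (κ : ℝ) (ψ : Fin 2 → ℂ) : ℝ := if ‖ψ 1‖ ^ 2 ≤ κ * ‖ψ 0‖ ^ 2 then 1 else 0

lemma measurable_cap (κ : ℝ) : Measurable (cap κ) :=
  Measurable.ite (measurableSet_le (by fun_prop) (by fun_prop)) measurable_const measurable_const

lemma integral_cap_zero {κ : ℝ} (hκ : 0 < κ) :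
    ∫ ψ, cap κ ψ * (gaussWeight ψ * ‖ψ 0‖ ^ 2) = 1 - 1 / (1 + κ) ^ 2 := by
  refine (integral_finTwo fun u v => (if ‖v‖ ^ 2 ≤ κ * ‖u‖ ^ 2 then 1 else 0) *
    (Real.exp (-(‖u‖ ^ 2 + ‖v‖ ^ 2)) / Real.pi ^ 2 * ‖u‖ ^ 2)).trans ?_
  have h1 : (fun q : ℂ × ℂ => (if ‖q.2‖ ^ 2 ≤ κ * ‖q.1‖ ^ 2 then (1 : ℝ) else 0) *
      (Real.exp (-(‖q.1‖ ^ 2 + ‖q.2‖ ^ 2)) / Real.pi ^ 2 * ‖q.1‖ ^ 2)) = fun q =>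
      (1 / Real.pi ^ 2 * (‖q.1‖ ^ 2 * Real.exp (-‖q.1‖ ^ 2))) *
        (if ‖q.2‖ ^ 2 ≤ κ * ‖q.1‖ ^ 2 then Real.exp (-‖q.2‖ ^ 2) else 0) := by
    ext q
    rw [neg_add, Real.exp_add]
    split_ifs <;> ring
  have h2 : Integrable (fun q : ℂ × ℂ => (1 / Real.pi ^ 2 * (‖q.1‖ ^ 2 * Real.exp (-‖q.1‖ ^ 2))) *
        (if ‖q.2‖ ^ 2 ≤ κ * ‖q.1‖ ^ 2 then Real.exp (-‖q.2‖ ^ 2) else 0)) := by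
    refine (((integrable_sq_exp.const_mul (1 / Real.pi ^ 2)).mul_prod integrable_exp).indicator
      (s := {q : ℂ × ℂ | ‖q.2‖ ^ 2 ≤ κ * ‖q.1‖ ^ 2})
      (measurableSet_le (by fun_prop) (by fun_prop))).congr
      (Filter.Eventually.of_forall fun q => ?_)
    by_cases h : ‖q.2‖ ^ 2 ≤ κ * ‖q.1‖ ^ 2 <;> simp [Set.indicator, h]
  rw [h1, Measure.volume_eq_prod, integral_prod _ h2]
  have h3 (u : ℂ) : ∫ v : ℂ, 1 / Real.pi ^ 2 * (‖u‖ ^ 2 * Real.exp (-‖u‖ ^ 2)) *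
      (if ‖v‖ ^ 2 ≤ κ * ‖u‖ ^ 2 then Real.exp (-‖v‖ ^ 2) else 0) =
      1 / Real.pi * (‖u‖ ^ 2 * Real.exp (-(1 * ‖u‖ ^ 2)) -
        ‖u‖ ^ 2 * Real.exp (-((1 + κ) * ‖u‖ ^ 2))) := by
    rw [integral_const_mul, integral_exp_of_le (by positivity)]
    have : Real.exp (-((1 + κ) * ‖u‖ ^ 2)) =
        Real.exp (-‖u‖ ^ 2) * Real.exp (-(κ * ‖u‖ ^ 2)) := by
      rw [← Real.exp_add]; congr 1; ring
    rw [this, one_mul]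
    have hpi := Real.pi_ne_zero
    field_simp
  simp_rw [h3]
  rw [integral_const_mul, integral_sub (integrable_sq_norm_mul_exp one_pos)
    (integrable_sq_norm_mul_exp (by positivity)), integral_sq_norm_mul_exp one_pos,
    integral_sq_norm_mul_exp (by positivity)]
  have hpi := Real.pi_ne_zero
  field_simp

/-- Here the factor `|ψ₁|²` is kept outside and `ψ₀` is integrated first, over the exterior of a
disc; in `integral_cap_zero` the order is the opposite. -/
lemma integral_cap_one {κ : ℝ} (hκ : 0 < κ) :
    ∫ ψ, cap κ ψ * (gaussWeight ψ * ‖ψ 1‖ ^ 2) = (κ / (1 + κ)) ^ 2 := by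
  refine (integral_finTwo fun u v => (if ‖v‖ ^ 2 ≤ κ * ‖u‖ ^ 2 then 1 else 0) *
    (Real.exp (-(‖u‖ ^ 2 + ‖v‖ ^ 2)) / Real.pi ^ 2 * ‖v‖ ^ 2)).trans ?_
  have h1 : (fun q : ℂ × ℂ => (if ‖q.2‖ ^ 2 ≤ κ * ‖q.1‖ ^ 2 then (1 : ℝ) else 0) *
      (Real.exp (-(‖q.1‖ ^ 2 + ‖q.2‖ ^ 2)) / Real.pi ^ 2 * ‖q.2‖ ^ 2)) = fun q =>
      (1 / Real.pi ^ 2 * (‖q.2‖ ^ 2 * Real.exp (-‖q.2‖ ^ 2))) *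
        (if ‖q.2‖ ^ 2 / κ ≤ ‖q.1‖ ^ 2 then Real.exp (-‖q.1‖ ^ 2) else 0) := by
    ext q
    simp_rw [div_le_iff₀' hκ]
    rw [neg_add, Real.exp_add]
    split_ifs <;> ring
  have h2 : Integrable (fun q : ℂ × ℂ => (1 / Real.pi ^ 2 * (‖q.2‖ ^ 2 * Real.exp (-‖q.2‖ ^ 2))) *
        (if ‖q.2‖ ^ 2 / κ ≤ ‖q.1‖ ^ 2 then Real.exp (-‖q.1‖ ^ 2) else 0)) := by
    refine ((integrable_exp.mul_prod (integrable_sq_exp.const_mul (1 / Real.pi ^ 2))).indicator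
      (s := {q : ℂ × ℂ | ‖q.2‖ ^ 2 / κ ≤ ‖q.1‖ ^ 2})
      (measurableSet_le (by fun_prop) (by fun_prop))).congr
      (Filter.Eventually.of_forall fun q => ?_)
    by_cases h : ‖q.2‖ ^ 2 / κ ≤ ‖q.1‖ ^ 2
    · simp [Set.indicator, h]; ring
    · simp [Set.indicator, h]
  rw [h1, Measure.volume_eq_prod, integral_prod_symm _ h2]
  have h3 (v : ℂ) : ∫ u : ℂ, 1 / Real.pi ^ 2 * (‖v‖ ^ 2 * Real.exp (-‖v‖ ^ 2)) *
      (if ‖v‖ ^ 2 / κ ≤ ‖u‖ ^ 2 then Real.exp (-‖u‖ ^ 2) else 0) =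
      1 / Real.pi * (‖v‖ ^ 2 * Real.exp (-((1 + 1 / κ) * ‖v‖ ^ 2))) := by
    rw [integral_const_mul, integral_exp_of_ge (by positivity)]
    have : Real.exp (-((1 + 1 / κ) * ‖v‖ ^ 2)) =
        Real.exp (-‖v‖ ^ 2) * Real.exp (-(‖v‖ ^ 2 / κ)) := by
      rw [← Real.exp_add]; congr 1; ring
    rw [this]
    have hpi := Real.pi_ne_zero
    field_simp
  simp_rw [h3]
  rw [integral_const_mul, integral_sq_norm_mul_exp (by positivity)]
  have hpi := Real.pi_ne_zero
  field_simp
  ring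

/-! ### Operators with a local hidden state response -/

/-- The parameter `c = 1 / (1 + κ)` makes the moments polynomial. The trace is `τ = 2 (1 - c)` and
the gap `2 c (1 - c) = τ (2 - τ) / 2`, the bound used in `exists_response_diag`. The cap depends on
moduli only, so nothing appears off the diagonal. -/
lemma integral_cap_hidden {c : ℝ} (h0 : 0 < c) (h1 : c < 1) (s t : Fin 2) :
    ∫ ψ, (cap ((1 - c) / c) ψ : ℂ) * hidden s t ψ =
      diagonal ![((1 - c ^ 2 : ℝ) : ℂ), (((1 - c) ^ 2 : ℝ) : ℂ)] s t := by
  have hκ : 0 < (1 - c) / c := div_pos (by linarith) h0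
  have e : 1 + (1 - c) / c = 1 / c := by field_simp; ring
  by_cases hst : s = t
  · subst hst
    rw [integral_response_hidden_diag, diagonal_apply_eq]
    fin_cases s
    · simp only [Fin.zero_eta, cons_val_zero]
      rw [integral_cap_zero hκ, e]
      congr 1
      field_simp
    · simp only [Fin.mk_one, cons_val_one]
      rw [integral_cap_one hκ, e]
      congr 1
      field_simp
  · rw [diagonal_apply_ne _ hst]
    exact integral_response_hidden_off (fun ψ => by simp [cap]) hst

lemma integral_affine_cap_hidden {c : ℝ} (h0 : 0 < c) (h1 : c < 1) (x y : ℝ) (s t : Fin 2) :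
    ∫ ψ, ((x + y * cap ((1 - c) / c) ψ : ℝ) : ℂ) * hidden s t ψ =
      diagonal ![((x + y * (1 - c ^ 2) : ℝ) : ℂ), ((x + y * (1 - c) ^ 2 : ℝ) : ℂ)] s t := by
  have hb (ψ) : |cap ((1 - c) / c) ψ| ≤ 1 := by
    unfold cap
    split_ifs <;> simp
  have h2 := integrable_response_hidden (measurable_cap ((1 - c) / c)) hb s t
  have h3 : (fun ψ => ((x + y * cap ((1 - c) / c) ψ : ℝ) : ℂ) * hidden s t ψ) = fun ψ =>
      (x : ℂ) * hidden s t ψ + y * ((cap ((1 - c) / c) ψ : ℂ) * hidden s t ψ) := by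
    ext ψ
    push_cast
    ring
  rw [h3, integral_add ((integrable_hidden s t).const_mul _) (h2.const_mul _),
    integral_const_mul, integral_const_mul, integral_hidden, integral_cap_hidden h0 h1]
  fin_cases s <;> fin_cases t <;> simp

/-- A cap of the right trace realises the extreme gap and the constant `τ / 2` realises gap zero;
mixing them with weights `k` and `1 - k` gives every gap in between. -/
lemma exists_response_diag {e : Fin 2 → ℝ} (h0 : 0 ≤ e 0 + e 1) (h2 : e 0 + e 1 ≤ 2)
    (h : |e 0 - e 1| ≤ (e 0 + e 1) * (2 - (e 0 + e 1)) / 2) :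
    ∃ P : (Fin 2 → ℂ) → ℝ, Measurable P ∧ (∀ ψ, 0 ≤ P ψ ∧ P ψ ≤ 1) ∧
      ∀ s t, ∫ ψ, (P ψ : ℂ) * hidden s t ψ = diagonal (fun k => (e k : ℂ)) s t := by
  set τ := e 0 + e 1 with hτ
  rcases eq_or_lt_of_le (show 0 ≤ τ * (2 - τ) / 2 by nlinarith) with hz | hz
  -- For `τ = 0` or `τ = 2` the cap degenerates, but then the gap is zero and a constant response
  -- suffices.
  · have he : e 0 = e 1 := by
      rw [← hz] at h
      linarith [abs_nonpos_iff.1 h]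
    refine ⟨fun _ => τ / 2, measurable_const, fun _ => ⟨by linarith, by linarith⟩, fun s t => ?_⟩
    rw [integral_const_mul, integral_hidden]
    have e0 : τ / 2 = e 0 := by linarith
    have e1 : τ / 2 = e 1 := by linarith
    by_cases hst : s = t
    · subst hst
      rw [if_pos rfl, mul_one, diagonal_apply_eq]
      fin_cases s
      · exact congrArg _ e0
      · exact congrArg _ e1
    · simp [hst]
  have hτ0 : 0 < τ := by
    rcases eq_or_lt_of_le h0 with h' | h'
    · rw [← h'] at hz; simp at hz
    · exact h'
  have hτ2 : τ < 2 := by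
    rcases eq_or_lt_of_le h2 with h' | h'
    · rw [h'] at hz; simp at hz
    · exact h'
  set k := |e 0 - e 1| / (τ * (2 - τ) / 2) with hk
  have hk0 : 0 ≤ k := by positivity
  have hk1 : k ≤ 1 := (div_le_one hz).2 h
  have hkm : k * (τ * (2 - τ) / 2) = |e 0 - e 1| := div_mul_cancel₀ _ hz.ne'
  have key (c x y : ℝ) (hc0 : 0 < c) (hc1 : c < 1) (hx0 : 0 ≤ x) (hx1 : x ≤ 1)
      (hxy0 : 0 ≤ x + y) (hxy1 : x + y ≤ 1) (he0 : x + y * (1 - c ^ 2) = e 0)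
      (he1 : x + y * (1 - c) ^ 2 = e 1) :
      ∃ P : (Fin 2 → ℂ) → ℝ, Measurable P ∧ (∀ ψ, 0 ≤ P ψ ∧ P ψ ≤ 1) ∧
      ∀ s t, ∫ ψ, (P ψ : ℂ) * hidden s t ψ = diagonal (fun k => (e k : ℂ)) s t := by
    refine ⟨fun ψ => x + y * cap ((1 - c) / c) ψ,
      ((measurable_cap _).const_mul y).const_add x, fun ψ => ?_, fun s t => ?_⟩
    · simp only [cap]
      split_ifs <;> constructor <;> linarith
    · rw [integral_affine_cap_hidden hc0 hc1, he0, he1]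
      congr 2
      ext k
      fin_cases k <;> rfl
  rcases le_total (e 1) (e 0) with hle | hle
  · rw [abs_of_nonneg (by linarith)] at hkm
    refine key (1 - τ / 2) ((1 - k) * (τ / 2)) k (by linarith) (by linarith) ?_ ?_ ?_ ?_ ?_ ?_
    all_goals nlinarith
  · rw [abs_of_nonpos (by linarith)] at hkm
    -- The larger eigenvalue is now the second one, so the complement of a cap is used; its trace is
    -- `2 c`, whence `c = τ / 2`.
    refine key (τ / 2) (k + (1 - k) * (τ / 2)) (-k) (by linarith) (by linarith) ?_ ?_ ?_ ?_ ?_ ?_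
    all_goals nlinarith

lemma hidden_mulVec (U : unitaryGroup (Fin 2) ℂ) (s t : Fin 2) (ψ : Fin 2 → ℂ) :
    hidden s t (U.1 *ᵥ ψ) = ∑ k, ∑ l, U.1 s k * star (U.1 t l) * hidden k l ψ := by
  rw [hidden, gaussWeight_unitary]
  simp only [mulVec, dotProduct, hidden, star_sum, star_mul]
  rw [Finset.sum_mul_sum, Finset.mul_sum]
  refine Finset.sum_congr rfl fun k _ => ?_
  rw [Finset.mul_sum]
  refine Finset.sum_congr rfl fun l _ => ?_
  ring

/-- An operator `A` with `0 ≤ tr A ≤ 2` whose eigenvalues differ by at most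
`tr A (2 - tr A) / 2` is the average of `|ψ⟩⟨ψ|` against a response function. -/
theorem exists_response {A : Matrix (Fin 2) (Fin 2) ℂ} (hA : A.IsHermitian) {τ : ℝ}
    (hτ : A.trace = τ) (h0 : 0 ≤ τ) (h2 : τ ≤ 2)
    (h : τ ^ 2 - 4 * A.det.re ≤ (τ * (2 - τ) / 2) ^ 2) :
    ∃ P : (Fin 2 → ℂ) → ℝ, Measurable P ∧ (∀ ψ, 0 ≤ P ψ ∧ P ψ ≤ 1) ∧
      ∀ s t, ∫ ψ, (P ψ : ℂ) * hidden s t ψ = A s t := by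
  set e := hA.eigenvalues with he
  have ht : e 0 + e 1 = τ := by
    have := hA.trace_eq_sum_eigenvalues
    rw [hτ, Fin.sum_univ_two] at this
    simpa [he] using (congrArg Complex.re this).symm
  have hd : A.det.re = e 0 * e 1 := by
    have := hA.det_eq_prod_eigenvalues
    rw [Fin.prod_univ_two] at this
    rw [this]
    simp [he]
  have hdiff : |e 0 - e 1| ≤ τ * (2 - τ) / 2 := by
    refine abs_le_of_sq_le_sq ?_ (by linarith [mul_nonneg h0 (sub_nonneg.2 h2)])
    rw [hd, ← ht] at h
    rw [← ht]
    nlinarith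
  rw [← ht] at h0 h2 hdiff
  obtain ⟨P, hPm, hP01, hP⟩ := exists_response_diag h0 h2 hdiff
  let U := hA.eigenvectorUnitary
  have hUU : star U.1 * U.1 = 1 := (mem_unitaryGroup_iff').1 U.2
  -- The Gaussian measure is unitarily invariant, so rotating the response conjugates its average
  -- into the eigenbasis of `A`.
  refine ⟨fun ψ => P (star U.1 *ᵥ ψ), hPm.comp (by fun_prop), fun ψ => hP01 _, fun s t => ?_⟩
  rw [← integral_comp_unitary U]
  simp only [mulVec_mulVec, hUU, one_mulVec, hidden_mulVec, Finset.mul_sum]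
  have hint (k l : Fin 2) : Integrable fun ψ =>
      (P ψ : ℂ) * (U.1 s k * star (U.1 t l) * hidden k l ψ) := by
    refine ((integrable_response_hidden hPm (C := 1)
      (fun ψ => abs_le.2 ⟨by linarith [(hP01 ψ).1], (hP01 ψ).2⟩) k l).const_mul
      (U.1 s k * star (U.1 t l))).congr (Filter.Eventually.of_forall fun ψ => ?_)
    simp only
    ring
  rw [integral_finsetSum _ fun k _ => integrable_finsetSum _ fun l _ => hint k l]
  have hA' : A = U.1 * diagonal (fun k => (e k : ℂ)) * star U.1 := by
    have := hA.spectral_theorem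
    rw [Unitary.conjStarAlgAut_apply] at this
    exact this
  rw [hA', Matrix.mul_assoc, Matrix.mul_apply]
  refine Finset.sum_congr rfl fun k _ => ?_
  rw [integral_finsetSum _ fun l _ => hint k l, Matrix.mul_apply, Finset.mul_sum]
  refine Finset.sum_congr rfl fun l _ => ?_
  simp_rw [mul_left_comm (P _ : ℂ)]
  rw [integral_const_mul, hP, star_apply]
  ring

/-! ### The pair state is unsteerable -/

/-- The inequality between Alice's marginal and the correlations behind unsteerability. -/
lemma unsteerable_ineq {α C : ℝ} (hα : 19 / 20 ≤ α) (hα1 : α < 1) (hC0 : 0 ≤ C) (hC1 : C < 1)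
    (hcond : 2 * α - 1 ≤ (2 - α) * α ^ 3 * C ^ 2) {y : ℝ} (hy0 : 0 ≤ y) (hy1 : y ≤ 1) :
    (α * (1 - C ^ 2) / (1 - α ^ 2 * C ^ 2)) ^ 2 * y +
      α * (α * (1 - C ^ 2) / (1 - α ^ 2 * C ^ 2)) * (1 - y) ≤
      ((1 - (C * (1 - α ^ 2) / (1 - α ^ 2 * C ^ 2)) ^ 2 * y) / 2) ^ 2 := by
  have hCC : C ^ 2 < 1 := by nlinarith
  have hCC0 : 0 ≤ C ^ 2 := sq_nonneg C
  have hα0 : 0 < α := by linarith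
  have hα2 : α ^ 2 < 1 := by nlinarith
  have hDα : 1 - α ^ 2 ≤ 1 - α ^ 2 * C ^ 2 := by nlinarith [sq_nonneg α]
  have hD : 0 < 1 - α ^ 2 * C ^ 2 := by linarith
  set D := 1 - α ^ 2 * C ^ 2 with hDdef
  set t := α * (1 - C ^ 2) / D with ht
  set κ := C * (1 - α ^ 2) / D with hκ
  have ht0 : 0 ≤ t := div_nonneg (mul_nonneg hα0.le (by linarith)) hD.le
  have hκeq : 1 - κ ^ 2 = (1 - C ^ 2) * (1 - α ^ 4 * C ^ 2) / D ^ 2 := by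
    rw [hκ, div_pow, eq_div_iff (by positivity), sub_mul, div_mul_cancel₀ _ (by positivity), hDdef]
    ring
  -- Cleared of denominators this is exactly `hcond`: it is the case `y = 1` of the claim, when
  -- Alice's effect is diagonal of rank one.
  have htt : t ≤ (1 - κ ^ 2) / 2 := by
    rw [hκeq, ht, div_div, div_le_div_iff₀ hD (by positivity)]
    have h1 : 2 * α * D ≤ 1 - α ^ 4 * C ^ 2 := by
      rw [hDdef]
      nlinarith
    have h2 : 0 ≤ (1 - C ^ 2) * D := mul_nonneg (by linarith) hD.le
    nlinarith
  have hα3 : 1 - α ≤ (2 - α) * α ^ 3 := by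
    have h1 : (19 / 20 : ℝ) ^ 3 ≤ α ^ 3 := pow_le_pow_left₀ (by norm_num) hα 3
    nlinarith
  -- The condition forces `C` near `1`, through the identity `(2 - α) α³ - (2α - 1) = (1 - α)³ (1 +
  -- α)`.
  have hgap : 1 - C ^ 2 ≤ (1 - α) ^ 2 * (1 + α) := by
    have hq : 0 < (2 - α) * α ^ 3 := by
      have : 0 < 2 - α := by linarith
      positivity
    have h1 : (2 - α) * α ^ 3 * (1 - C ^ 2) ≤ (1 - α) * ((1 - α) ^ 2 * (1 + α)) := by nlinarith
    have h2 : (1 - α) * ((1 - α) ^ 2 * (1 + α)) ≤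
        (2 - α) * α ^ 3 * ((1 - α) ^ 2 * (1 + α)) :=
      mul_le_mul_of_nonneg_right hα3 (by positivity)
    exact le_of_mul_le_mul_left (h1.trans h2) hq
  have ht1 : (1 - κ ^ 2) / 2 ≤ 1 - α := by
    rw [hκeq, div_div, div_le_iff₀ (by positivity)]
    have h1 : 1 - α ^ 4 * C ^ 2 ≤ 2 * D := by
      rw [hDdef]
      nlinarith [mul_nonneg hCC0 (sq_nonneg (1 - α ^ 2))]
    have h2 : 1 - C ^ 2 ≤ (1 - α) * D := by
      have : (1 - α) * (1 - α ^ 2) ≤ (1 - α) * D :=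
        mul_le_mul_of_nonneg_left hDα (by linarith)
      nlinarith
    calc (1 - C ^ 2) * (1 - α ^ 4 * C ^ 2) ≤ (1 - C ^ 2) * (2 * D) :=
          mul_le_mul_of_nonneg_left h1 (by linarith)
      _ ≤ ((1 - α) * D) * (2 * D) := mul_le_mul_of_nonneg_right h2 (by linarith)
      _ = _ := by ring
  generalize hT : (1 - κ ^ 2) / 2 = T at htt ht1
  have hκT : κ ^ 2 = 1 - 2 * T := by linarith
  rw [hκT]
  have hT0 : 0 ≤ T := ht0.trans htt
  have h1 : t ^ 2 * y ≤ T ^ 2 * y := mul_le_mul_of_nonneg_right (by nlinarith) hy0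
  have h2 : α * t * (1 - y) ≤ α * T * (1 - y) :=
    mul_le_mul_of_nonneg_right (mul_le_mul_of_nonneg_left htt hα0.le) (by linarith)
  have h3 : 0 ≤ (1 - y) * (T * (1 - α - T)) :=
    mul_nonneg (by linarith) (mul_nonneg hT0 (by linarith))
  -- From `t ≤ T ≤ 1 - α`, right minus left is at least `(1 - y)² (1 - 2T)² / 4`.
  nlinarith [sq_nonneg ((1 - y) * (1 - 2 * T))]

/-- The operator `Tr_A[(Q ⊗ 𝟙) ρ_{α,θ}]`. -/
def assemblage (α θ : ℝ) (Q : Matrix (Fin 2) (Fin 2) ℂ) : Matrix (Fin 2) (Fin 2) ℂ :=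
  !![((Real.cos θ ^ 2 * ((1 + α) / 2) : ℝ) : ℂ) * Q 0 0 +
      ((Real.sin θ ^ 2 * ((1 - α) / 2) : ℝ) : ℂ) * Q 1 1,
    ((α * Real.cos θ * Real.sin θ : ℝ) : ℂ) * Q 1 0;
    ((α * Real.cos θ * Real.sin θ : ℝ) : ℂ) * Q 0 1,
    ((Real.cos θ ^ 2 * ((1 - α) / 2) : ℝ) : ℂ) * Q 0 0 +
      ((Real.sin θ ^ 2 * ((1 + α) / 2) : ℝ) : ℂ) * Q 1 1]

/-- The qubit block of a qutrit operator. -/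
def qubitBlock (M : Matrix (Fin 3) (Fin 3) ℂ) : Matrix (Fin 2) (Fin 2) ℂ :=
  M.submatrix Fin.castSucc Fin.castSucc

lemma blockFun_eq_assemblage (α θ : ℝ) (s t : Fin 2) (M : Matrix (Fin 3) (Fin 3) ℂ) :
    blockFun α θ s t M = assemblage α θ (qubitBlock M) s t +
      if s = t then M 2 2 * (bobWeight α θ s : ℂ) else 0 := by
  fin_cases s <;> fin_cases t <;>
  simp [blockFun_zero_zero, blockFun_one_one, blockFun_zero_one, blockFun_one_zero, assemblage,
    qubitBlock, bobWeight, -Complex.ofReal_cos, -Complex.ofReal_sin] <;> ring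

lemma assemblage_sum {A : Type} [Fintype A] (α θ : ℝ) (Q : A → Matrix (Fin 2) (Fin 2) ℂ)
    (s t : Fin 2) :
    ∑ a, assemblage α θ (Q a) s t = assemblage α θ (∑ a, Q a) s t := by
  fin_cases s <;> fin_cases t <;>
  simp [assemblage, Matrix.sum_apply, Finset.mul_sum, Finset.sum_add_distrib,
    -Complex.ofReal_cos, -Complex.ofReal_sin]

lemma assemblage_one (α θ : ℝ) (s t : Fin 2) :
    assemblage α θ 1 s t = if s = t then (bobWeight α θ s : ℂ) else 0 := by
  fin_cases s <;> fin_cases t <;>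
  simp [assemblage, bobWeight, -Complex.ofReal_cos, -Complex.ofReal_sin]

lemma PosSemidef.fin_two {Q : Matrix (Fin 2) (Fin 2) ℂ} (hQ : Q.PosSemidef) :
    ∃ a d : ℝ, Q 0 0 = a ∧ Q 1 1 = d ∧ 0 ≤ a ∧ 0 ≤ d ∧ Q 0 1 = star (Q 1 0) ∧
      ‖Q 1 0‖ ^ 2 ≤ a * d := by
  have h0 := hQ.diag_nonneg (i := 0)
  have h1 := hQ.diag_nonneg (i := 1)
  rw [Complex.le_def] at h0 h1
  have e0 : Q 0 0 = ((Q 0 0).re : ℂ) := Complex.ext (by simp) (by simpa using h0.2.symm)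
  have e1 : Q 1 1 = ((Q 1 1).re : ℂ) := Complex.ext (by simp) (by simpa using h1.2.symm)
  have h01 : Q 0 1 = star (Q 1 0) := (hQ.1.apply 0 1).symm
  refine ⟨_, _, e0, e1, h0.1, h1.1, h01, ?_⟩
  have hd := hQ.det_nonneg
  rw [det_fin_two, h01, e0, e1, RCLike.star_def, Complex.conj_mul'] at hd
  have : (0 : ℂ) ≤ (((Q 0 0).re * (Q 1 1).re - ‖Q 1 0‖ ^ 2 : ℝ) : ℂ) := by
    push_cast
    exact hd
  linarith [Complex.zero_le_real.1 this]

/-- Here `a`, `d` and `V` are the diagonal entries and the squared off-diagonal modulus of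
`ρ_B^{-1/2} σ ρ_B^{-1/2} / tr Q`, with `σ` the steered operator and `x` the normalised diagonal
difference of `Q`. The trace is `1 + κ x` and `a - d = t x`, so the last bound is `unsteerable_ineq`
at `y = x²`. -/
lemma steered_trace_det {α C x V a d : ℝ} (hα : 19 / 20 ≤ α) (hα1 : α < 1) (hC0 : 0 ≤ C)
    (hC1 : C < 1) (hcond : 2 * α - 1 ≤ (2 - α) * α ^ 3 * C ^ 2) (hx : x ^ 2 ≤ 1)
    (ha : a = (1 + x * C + α * (x + C)) / (2 * (1 + α * C)))
    (hd : d = (1 + x * C - α * (x + C)) / (2 * (1 - α * C)))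
    (hV : 4 * V ≤ α ^ 2 * (1 - C ^ 2) * (1 - x ^ 2) / (1 - α ^ 2 * C ^ 2)) :
    0 ≤ a + d ∧ a + d ≤ 2 ∧
      (a + d) ^ 2 - 4 * (a * d - V) ≤ ((a + d) * (2 - (a + d)) / 2) ^ 2 := by
  have hα0 : 0 < α := by linarith
  have hαC : α * C < 1 := by nlinarith
  have hαC0 : 0 ≤ α * C := by positivity
  have h1 : 0 < 1 - α * C := by linarith
  have h2 : 0 < 1 + α * C := by linarith
  have hDe : 1 - α ^ 2 * C ^ 2 = (1 - α * C) * (1 + α * C) := by ring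
  have hD : 0 < 1 - α ^ 2 * C ^ 2 := by rw [hDe]; positivity
  have h1' : 1 - C * α ≠ 0 := by linarith
  have hsum : a + d = 1 + C * (1 - α ^ 2) / (1 - α ^ 2 * C ^ 2) * x := by
    rw [ha, hd, hDe]
    field_simp
    ring
  have hdiff : a - d = α * (1 - C ^ 2) / (1 - α ^ 2 * C ^ 2) * x := by
    rw [ha, hd, hDe]
    field_simp
    ring
  have hineq := unsteerable_ineq hα hα1 hC0 hC1 hcond (sq_nonneg x) hx
  have hα2 : 0 ≤ 1 - α ^ 2 := by nlinarith
  have hκ0 : 0 ≤ C * (1 - α ^ 2) / (1 - α ^ 2 * C ^ 2) :=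
    div_nonneg (mul_nonneg hC0 hα2) hD.le
  have hκ1 : C * (1 - α ^ 2) / (1 - α ^ 2 * C ^ 2) ≤ 1 := by
    rw [div_le_one hD]
    nlinarith [mul_nonneg (sub_nonneg.2 hC1.le) (by positivity : 0 ≤ 1 + α ^ 2 * C)]
  have hV' : 4 * V ≤ α * (α * (1 - C ^ 2) / (1 - α ^ 2 * C ^ 2)) * (1 - x ^ 2) := by
    refine hV.trans (le_of_eq ?_)
    ring
  set κ := C * (1 - α ^ 2) / (1 - α ^ 2 * C ^ 2)
  set t := α * (1 - C ^ 2) / (1 - α ^ 2 * C ^ 2)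
  have hκx : |κ * x| ≤ 1 := by
    rw [abs_mul, abs_of_nonneg hκ0]
    exact mul_le_one₀ hκ1 (abs_nonneg _) ((sq_le_one_iff_abs_le_one x).1 hx)
  rw [abs_le] at hκx
  refine ⟨by linarith, by linarith, ?_⟩
  calc (a + d) ^ 2 - 4 * (a * d - V) = (a - d) ^ 2 + 4 * V := by ring
    _ ≤ t ^ 2 * x ^ 2 + α * t * (1 - x ^ 2) := by rw [hdiff, mul_pow]; linarith
    _ ≤ ((1 - κ ^ 2 * x ^ 2) / 2) ^ 2 := hineq
    _ = _ := by rw [hsum]; ring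

/-- Alice's outcome on the pair state has a local hidden state response, the hidden states being
`√ρ_B |ψ⟩⟨ψ| √ρ_B`. -/
theorem exists_pair_response {α θ : ℝ} (hα : 19 / 20 ≤ α) (hα1 : α < 1)
    (hθ : θ ∈ Set.Ioc 0 (Real.pi / 4)) (hcond : UnsteerableCond α θ)
    {Q : Matrix (Fin 2) (Fin 2) ℂ} (hQ : Q.PosSemidef) :
    ∃ f : (Fin 2 → ℂ) → ℝ, Measurable f ∧ (∀ ψ, 0 ≤ f ψ ∧ f ψ ≤ Q.trace.re) ∧
      ∀ s t, ∫ ψ, (f ψ : ℂ) * hidden s t ψ = assemblage α θ Q s t /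
        ((Real.sqrt (bobWeight α θ s) : ℂ) * (Real.sqrt (bobWeight α θ t) : ℂ)) := by
  obtain ⟨a, d, ha, hd, ha0, hd0, h01, hw⟩ := PosSemidef.fin_two hQ
  have hT : Q.trace.re = a + d := by
    rw [trace_fin_two, ha, hd]
    simp
  rw [hT]
  -- A positive operator of trace zero vanishes, so the zero response works; otherwise division by
  -- the trace is allowed.
  rcases eq_or_lt_of_le (add_nonneg ha0 hd0) with hT0 | hT0
  · have ha' : a = 0 := by linarith
    have hd' : d = 0 := by linarith
    have hw' : Q 1 0 = 0 := by
      rw [ha', zero_mul] at hw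
      simpa using le_antisymm hw (sq_nonneg _)
    refine ⟨fun _ => 0, measurable_const, fun _ => ⟨le_rfl, hT0.le⟩, fun s t => ?_⟩
    fin_cases s <;> fin_cases t <;> simp [assemblage, ha, hd, ha', hd', h01, hw']
  have hpi := Real.pi_pos
  set C := Real.cos (2 * θ) with hC
  have hC0 : 0 ≤ C := Real.cos_nonneg_of_neg_pi_div_two_le_of_le (by linarith [hθ.1])
    (by linarith [hθ.2])
  have hC1 : C < 1 := by
    rw [hC, ← Real.cos_zero]
    exact Real.cos_lt_cos_of_nonneg_of_le_pi le_rfl (by linarith [hθ.2]) (by linarith [hθ.1])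
  have hcos : Real.cos θ ^ 2 = (1 + C) / 2 := by rw [hC, Real.cos_two_mul]; ring
  have hsin : Real.sin θ ^ 2 = (1 - C) / 2 := by rw [Real.sin_sq, hcos]; ring
  have hα0 : 0 < α := by linarith
  have hcond' : 2 * α - 1 ≤ (2 - α) * α ^ 3 * C ^ 2 := by
    have h1 : 0 < (2 - α) * α ^ 3 := mul_pos (by linarith) (by positivity)
    exact (div_le_iff₀' h1).1 hcond
  have hαC : α * C < 1 := by nlinarith
  have hαC0 : 0 ≤ α * C := by positivity
  have hb0 : bobWeight α θ 0 = (1 + α * C) / 2 := by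
    simp only [bobWeight, cons_val_zero, hcos, hsin]; ring
  have hb1 : bobWeight α θ 1 = (1 - α * C) / 2 := by
    change Real.cos θ ^ 2 * ((1 - α) / 2) + Real.sin θ ^ 2 * ((1 + α) / 2) = _
    rw [hcos, hsin]; ring
  have hbpos (s : Fin 2) : 0 < bobWeight α θ s := by
    fin_cases s
    · simp only [Fin.zero_eta, hb0]; linarith
    · simp only [Fin.mk_one, hb1]; linarith
  have hsq (s : Fin 2) : ((Real.sqrt (bobWeight α θ s) : ℝ) : ℂ) *
      (Real.sqrt (bobWeight α θ s) : ℝ) = (bobWeight α θ s : ℂ) := by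
    exact_mod_cast Real.mul_self_sqrt (hbpos s).le
  let T := a + d
  let x := (a - d) / T
  have hTx : a - d = T * x := by
    have h2 : T ≠ 0 := hT0.ne'
    simp only [x]; field_simp
  have haT : a = T * (1 + x) / 2 := by
    have : a + d = T := rfl
    linarith
  have hdT : d = T * (1 - x) / 2 := by
    have : a + d = T := rfl
    linarith
  have hx : x ^ 2 ≤ 1 := by
    have h1 : (T * x) ^ 2 ≤ T ^ 2 * 1 := by
      rw [← hTx]
      have : (a - d) ^ 2 ≤ (a + d) ^ 2 := by nlinarith [mul_nonneg ha0 hd0]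
      simpa [T] using this
    rw [mul_pow] at h1
    exact le_of_mul_le_mul_left h1 (by positivity)
  let a' := (1 + x * C + α * (x + C)) / (2 * (1 + α * C))
  let d' := (1 + x * C - α * (x + C)) / (2 * (1 - α * C))
  let V := (α * Real.cos θ * Real.sin θ) ^ 2 * ‖Q 1 0‖ ^ 2 /
    (T ^ 2 * (bobWeight α θ 0 * bobWeight α θ 1))
  have hV : 4 * V ≤ α ^ 2 * (1 - C ^ 2) * (1 - x ^ 2) / (1 - α ^ 2 * C ^ 2) := by
    have hDe : 1 - α ^ 2 * C ^ 2 = 4 * (bobWeight α θ 0 * bobWeight α θ 1) := by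
      rw [hb0, hb1]; ring
    have hbb : 0 < bobWeight α θ 0 * bobWeight α θ 1 := mul_pos (hbpos 0) (hbpos 1)
    have hw' : ‖Q 1 0‖ ^ 2 ≤ T ^ 2 * ((1 - x ^ 2) / 4) := by
      refine hw.trans (le_of_eq ?_)
      rw [haT, hdT]; ring
    have hcs : (α * Real.cos θ * Real.sin θ) ^ 2 = α ^ 2 * (1 - C ^ 2) / 4 := by
      rw [mul_pow, mul_pow, hcos, hsin]; ring
    rw [hDe]
    simp only [V]
    rw [hcs, ← mul_div_assoc, div_le_div_iff₀ (by positivity) (by positivity)]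
    have h3 : 0 ≤ α ^ 2 * (1 - C ^ 2) * (bobWeight α θ 0 * bobWeight α θ 1) := by
      have : 0 ≤ 1 - C ^ 2 := by nlinarith
      positivity
    nlinarith [mul_le_mul_of_nonneg_left hw' h3]
  obtain ⟨hτ0, hτ2, hdisc⟩ := steered_trace_det hα hα1 hC0 hC1 hcond' hx
    (a := a') (d := d') rfl rfl hV
  -- Conjugation by `ρ_B^{-1/2}` reduces the problem to isotropic hidden states. Dividing by `T`
  -- lets `exists_response` apply, and multiplying back gives the bound `f ≤ tr Q`.
  let A : Matrix (Fin 2) (Fin 2) ℂ := Matrix.of fun s t => assemblage α θ Q s t /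
    ((T : ℂ) * ((Real.sqrt (bobWeight α θ s) : ℂ) * (Real.sqrt (bobWeight α θ t) : ℂ)))
  have hTC : (T : ℂ) ≠ 0 := by exact_mod_cast hT0.ne'
  have hA0 : A 0 0 = a' := by
    simp only [A, of_apply, hsq, assemblage, cons_val_zero, ha, hd]
    norm_cast
    simp only [a', hb0, hcos, hsin, haT, hdT]
    have h1 : 1 + α * C ≠ 0 := by linarith
    have h2 : T ≠ 0 := hT0.ne'
    field_simp
    ring
  have hA1 : A 1 1 = d' := by
    have e : A 1 1 = (((Real.cos θ ^ 2 * ((1 - α) / 2) : ℝ) : ℂ) * Q 0 0 +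
      ((Real.sin θ ^ 2 * ((1 + α) / 2) : ℝ) : ℂ) * Q 1 1) / ((T : ℂ) *
        ((Real.sqrt (bobWeight α θ 1) : ℂ) * (Real.sqrt (bobWeight α θ 1) : ℂ))) := rfl
    rw [e, hsq, ha, hd]
    norm_cast
    simp only [d', hb1, hcos, hsin, haT, hdT]
    have h1 : 1 - α * C ≠ 0 := by linarith
    have h2 : T ≠ 0 := hT0.ne'
    field_simp
    ring
  have hA01 : A 0 1 * A 1 0 = V := by
    have h1 : A 0 1 * A 1 0 = (((α * Real.cos θ * Real.sin θ : ℝ) : ℂ) ^ 2 *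
        (Q 0 1 * Q 1 0)) / ((T : ℂ) ^ 2 * ((bobWeight α θ 0 : ℂ) * (bobWeight α θ 1 : ℂ))) := by
      rw [← hsq 0, ← hsq 1]
      simp only [A, of_apply, assemblage, cons_val_zero, cons_val_one]
      rw [div_mul_div_comm]
      congr 1 <;> ring
    rw [h1, h01, RCLike.star_def, Complex.conj_mul']
    simp only [V]
    push_cast
    ring
  have hAH : A.IsHermitian := by
    ext s t
    fin_cases s <;> fin_cases t
    · simp [hA0]
    · simp [A, assemblage, h01, -Complex.ofReal_cos, -Complex.ofReal_sin, mul_comm]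
    · simp [A, assemblage, h01, -Complex.ofReal_cos, -Complex.ofReal_sin, mul_comm]
    · simp [hA1]
  obtain ⟨P, hPm, hP01, hP⟩ := exists_response hAH (τ := a' + d')
    (by rw [trace_fin_two, hA0, hA1]; push_cast; rfl) hτ0 hτ2
    (by
      rw [det_fin_two, hA0, hA1, hA01]
      norm_cast)
  refine ⟨fun ψ => T * P ψ, hPm.const_mul T, fun ψ => ⟨mul_nonneg hT0.le (hP01 ψ).1,
    mul_le_of_le_one_right hT0.le (hP01 ψ).2⟩, fun s t => ?_⟩
  have : (fun ψ => ((T * P ψ : ℝ) : ℂ) * hidden s t ψ) =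
      fun ψ => (T : ℂ) * ((P ψ : ℂ) * hidden s t ψ) := by
    ext ψ
    push_cast
    ring
  rw [this, integral_const_mul, hP]
  simp only [A, of_apply]
  rw [← mul_div_assoc, mul_div_mul_left _ _ hTC]

/-! ### The local model -/

/-- The matrix elements of Bob's hidden state `√ρ_B |ψ⟩⟨ψ| √ρ_B`, with the Gaussian weight. -/
def bobHidden (α θ : ℝ) (s t : Fin 2) (ψ : Fin 2 → ℂ) : ℂ :=
  ((Real.sqrt (bobWeight α θ s) : ℂ) * (Real.sqrt (bobWeight α θ t) : ℂ)) * hidden s t ψ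

/-- The unnormalised probability of the central outcome for given hidden states. -/
def centralWeight (N : ℕ) (α θ : ℝ) (l : Fin N → Fin 2 → ℂ) : ℝ :=
  Complex.normSq (∑ s, ∏ n, (Real.sqrt (bobWeight α θ s) : ℂ) *
    ((Real.sqrt (gaussWeight (l n)) : ℂ) * l n s))

lemma centralWeight_eq {N : ℕ} (α θ : ℝ) (l : Fin N → Fin 2 → ℂ) :
    (centralWeight N α θ l : ℂ) = ∑ s, ∑ t, ∏ n, bobHidden α θ s t (l n) := by
  rw [centralWeight, ← Complex.mul_conj, map_sum, Finset.sum_mul_sum]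
  refine Finset.sum_congr rfl fun s _ => Finset.sum_congr rfl fun t _ => ?_
  rw [map_prod, ← Finset.prod_mul_distrib]
  refine Finset.prod_congr rfl fun n _ => ?_
  have h : ((Real.sqrt (gaussWeight (l n)) : ℝ) : ℂ) * (Real.sqrt (gaussWeight (l n)) : ℝ) =
      (gaussWeight (l n) : ℂ) := by
    exact_mod_cast Real.mul_self_sqrt (gaussWeight_nonneg _)
  simp only [bobHidden, hidden, ← h, map_mul, Complex.conj_ofReal, RCLike.star_def]
  ring

lemma continuous_centralWeight (N : ℕ) (α θ : ℝ) : Continuous (centralWeight N α θ) := by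
  unfold centralWeight
  have := continuous_gaussWeight
  fun_prop

/-- Averages of products of local functions against the central weight. -/
lemma integral_centralWeight_mul_prod {N : ℕ} (α θ : ℝ) {f : Fin N → (Fin 2 → ℂ) → ℝ}
    (hf : ∀ n, Measurable (f n)) (hf1 : ∀ n ψ, |f n ψ| ≤ 1) :
    Integrable (fun l => centralWeight N α θ l * ∏ n, f n (l n)) ∧
    ((∫ l, centralWeight N α θ l * ∏ n, f n (l n) : ℝ) : ℂ) =
      ∑ s, ∑ t, ∏ n, ∫ ψ, (f n ψ : ℂ) * bobHidden α θ s t ψ := by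
  have hi (s t : Fin 2) (n : Fin N) : Integrable fun ψ => (f n ψ : ℂ) * bobHidden α θ s t ψ := by
    refine ((integrable_response_hidden (hf n) (hf1 n) s t).const_mul
      ((Real.sqrt (bobWeight α θ s) : ℂ) * (Real.sqrt (bobWeight α θ t) : ℂ))).congr
      (Filter.Eventually.of_forall fun ψ => ?_)
    simp only [bobHidden]
    ring
  have hp (s t : Fin 2) : Integrable fun l : Fin N → Fin 2 → ℂ =>
      ∏ n, (f n (l n) : ℂ) * bobHidden α θ s t (l n) :=
    Integrable.fintype_prod (f := fun n ψ => (f n ψ : ℂ) * bobHidden α θ s t ψ) (hi s t)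
  have he (l : Fin N → Fin 2 → ℂ) : ((centralWeight N α θ l * ∏ n, f n (l n) : ℝ) : ℂ) =
      ∑ s, ∑ t, ∏ n, (f n (l n) : ℂ) * bobHidden α θ s t (l n) := by
    push_cast
    simp_rw [centralWeight_eq, Finset.prod_mul_distrib, ← Finset.mul_sum]
    ring
  have hsum : Integrable fun l : Fin N → Fin 2 → ℂ =>
      ∑ s, ∑ t, ∏ n, (f n (l n) : ℂ) * bobHidden α θ s t (l n) :=
    integrable_finsetSum _ fun s _ => integrable_finsetSum _ fun t _ => hp s t
  constructor
  · refine hsum.re.congr (Filter.Eventually.of_forall fun l => ?_)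
    simp only
    rw [← he]
    exact Complex.ofReal_re _
  · rw [← integral_complex_ofReal]
    simp_rw [he]
    rw [integral_finsetSum _ fun s _ => integrable_finsetSum _ fun t _ => hp s t]
    refine Finset.sum_congr rfl fun s _ => ?_
    rw [integral_finsetSum _ fun t _ => hp s t]
    refine Finset.sum_congr rfl fun t _ => ?_
    exact integral_fintype_prod_volume_eq_prod
      (fun n (ψ : Fin 2 → ℂ) => (f n ψ : ℂ) * bobHidden α θ s t ψ)

/-- The response of a party holding a qutrit: `f a` simulates the qubit block of the `a`-th POVM
element, and the remaining probability is distributed according to `q`. -/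
def paddedResponse {A : Type} [Fintype A] (f q : A → ℝ) (a : A) : ℝ :=
  1 / 2 * f a + 1 / 2 * q a * (2 - ∑ a', f a')

lemma paddedResponse_nonneg {A : Type} [Fintype A] {f q : A → ℝ} (hf : ∀ a, 0 ≤ f a)
    (hf2 : ∑ a, f a ≤ 2) (hq : ∀ a, 0 ≤ q a) (a : A) : 0 ≤ paddedResponse f q a :=
  add_nonneg (mul_nonneg (by norm_num) (hf a))
    (mul_nonneg (mul_nonneg (by norm_num) (hq a)) (by linarith))

lemma sum_paddedResponse {A : Type} [Fintype A] {f q : A → ℝ} (hq : ∑ a, q a = 1) :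
    ∑ a, paddedResponse f q a = 1 := by
  simp_rw [paddedResponse, Finset.sum_add_distrib, ← Finset.sum_mul, ← Finset.mul_sum, hq]
  ring

/-- The functions `f a` together average to Bob's reduced state `ρ_B`, so `2 - ∑ f` averages to `2
ρ_B - ρ_B = ρ_B`. That is the state Bob holds when Alice has the flag, where her outcome has
distribution `q`. -/
lemma integral_paddedResponse {A : Type} [Fintype A] {α θ : ℝ}
    (hb : ∀ s, 0 < bobWeight α θ s) {M : A → Matrix (Fin 3) (Fin 3) ℂ} (hM : ∑ a, M a = 1)
    {f : A → (Fin 2 → ℂ) → ℝ} (hfm : ∀ a, Measurable (f a)) {C : ℝ}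
    (hfC : ∀ a ψ, |f a ψ| ≤ C)
    (hf : ∀ a s t, ∫ ψ, (f a ψ : ℂ) * hidden s t ψ = assemblage α θ (qubitBlock (M a)) s t /
        ((Real.sqrt (bobWeight α θ s) : ℂ) * (Real.sqrt (bobWeight α θ t) : ℂ)))
    {q : A → ℝ} (hq : ∀ a, M a 2 2 = q a) (a : A) (s t : Fin 2) :
    ∫ ψ, (paddedResponse (fun a => f a ψ) q a : ℂ) * bobHidden α θ s t ψ =
      1 / 2 * blockFun α θ s t (M a) := by
  have hi (a : A) := integrable_response_hidden (hfm a) (hfC a) s t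
  have hr (s : Fin 2) : ((Real.sqrt (bobWeight α θ s) : ℝ) : ℂ) ≠ 0 := by
    exact_mod_cast (Real.sqrt_pos.2 (hb s)).ne'
  set r := ((Real.sqrt (bobWeight α θ s) : ℝ) : ℂ) * ((Real.sqrt (bobWeight α θ t) : ℝ) : ℂ)
    with hrdef
  have hr0 : r ≠ 0 := mul_ne_zero (hr s) (hr t)
  have hexp : (fun ψ => (paddedResponse (fun a => f a ψ) q a : ℂ) * bobHidden α θ s t ψ) =
      fun ψ => r / 2 * ((f a ψ : ℂ) * hidden s t ψ) + (r * q a * hidden s t ψ -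
        r * q a / 2 * ∑ a', (f a' ψ : ℂ) * hidden s t ψ) := by
    ext ψ
    simp only [paddedResponse, bobHidden, ← hrdef, ← Finset.sum_mul]
    push_cast
    ring
  have hsumi : Integrable fun ψ => ∑ a', (f a' ψ : ℂ) * hidden s t ψ :=
    integrable_finsetSum _ fun a' _ => hi a'
  have hblock : ∑ a', qubitBlock (M a') = 1 := by
    have : ∑ a', qubitBlock (M a') = qubitBlock (∑ a', M a') := by
      ext i j
      simp [qubitBlock, Matrix.sum_apply]
    rw [this, hM, qubitBlock, submatrix_one _ (Fin.castSucc_injective 2)]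
  have hrest : Integrable fun ψ => r * q a * hidden s t ψ -
      r * q a / 2 * ∑ a', (f a' ψ : ℂ) * hidden s t ψ :=
    ((integrable_hidden s t).const_mul _).sub (hsumi.const_mul _)
  rw [hexp, integral_add ((hi a).const_mul _) hrest,
    integral_sub ((integrable_hidden s t).const_mul _) (hsumi.const_mul _),
    integral_const_mul, integral_const_mul, integral_const_mul,
    integral_finsetSum _ fun a' _ => hi a', integral_hidden, hf]
  simp_rw [hf]
  rw [← hrdef, ← Finset.sum_div, assemblage_sum, hblock, assemblage_one, blockFun_eq_assemblage,
    hq]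
  by_cases hst : s = t
  · subst hst
    have h1 : r = (bobWeight α θ s : ℂ) := by
      rw [hrdef]
      exact_mod_cast Real.mul_self_sqrt (hb s).le
    simp only [if_true]
    rw [← h1]
    field_simp
    ring
  · simp only [hst, if_false]
    field_simp
    ring

/-- The hidden variable is the family of `N` vectors, with density `centralWeight / Z`. This density
correlates the parties but does not depend on the measurements, while each party responds to its own
vector only. -/
theorem rhoGME_isFullyLocal {N : ℕ} (hN : N ≠ 0) {α θ : ℝ} (hα : 19 / 20 ≤ α) (hα1 : α < 1)
    (hθ : θ ∈ Set.Ioc 0 (Real.pi / 4)) (hc : Real.cos θ ≠ 0) (hs : Real.sin θ ≠ 0)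
    (hcond : UnsteerableCond α θ) : IsFullyLocal (rhoGME N α θ) := by
  intro X A _ M hM
  have hb := bobWeight_pos (α := α) (θ := θ) ⟨by linarith, hα1.le⟩ hc hs
  have hblock (n x a) : (qubitBlock (M n x a)).PosSemidef := ((hM n x).1 a).submatrix _
  choose f hfm hf0 hf using fun n x a => exists_pair_response hα hα1 hθ hcond (hblock n x a)
  set q : Fin N → X → A → ℝ := fun n x a => (M n x a 2 2).re with hqdef
  have hq (n x a) : M n x a 2 2 = q n x a := by
    have h0 := ((hM n x).1 a).diag_nonneg (i := 2)
    rw [Complex.le_def] at h0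
    exact Complex.ext (by simp [hqdef]) (by simpa using h0.2.symm)
  have hq0 (n x a) : 0 ≤ q n x a := by
    have h0 := ((hM n x).1 a).diag_nonneg (i := 2)
    exact (Complex.le_def.1 h0).1
  have hq1 (n x) : ∑ a, q n x a = 1 := by
    have h := congrArg (fun B : Matrix (Fin 3) (Fin 3) ℂ => (B 2 2).re) (hM n x).2
    simpa [Matrix.sum_apply] using h
  have htr (n x) : ∑ a, (qubitBlock (M n x a)).trace.re = 2 := by
    have h0 := congrArg (fun B : Matrix (Fin 3) (Fin 3) ℂ => (B 0 0).re) (hM n x).2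
    have h1 := congrArg (fun B : Matrix (Fin 3) (Fin 3) ℂ => (B 1 1).re) (hM n x).2
    simp only [Matrix.sum_apply, Complex.re_sum, one_apply_eq, Complex.one_re] at h0 h1
    simp only [trace_fin_two, qubitBlock, submatrix_apply, Complex.add_re,
      Finset.sum_add_distrib, Fin.castSucc_zero, Fin.castSucc_one]
    rw [h0, h1]
    norm_num
  have hfsum (n x ψ) : ∑ a, f n x a ψ ≤ 2 := by
    rw [← htr n x]
    exact Finset.sum_le_sum fun a _ => (hf0 n x a ψ).2
  have hf2 (n x a ψ) : |f n x a ψ| ≤ 2 := by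
    rw [abs_of_nonneg (hf0 n x a ψ).1]
    exact (Finset.single_le_sum (f := fun a => f n x a ψ) (fun a _ => (hf0 n x a ψ).1)
      (Finset.mem_univ a)).trans (hfsum n x ψ)
  let P (n : Fin N) (l : Fin N → Fin 2 → ℂ) (x : X) (a : A) : ℝ :=
    paddedResponse (fun a => f n x a (l n)) (q n x) a
  have hP (n l) : IsResponse (P n l) := fun x =>
    ⟨paddedResponse_nonneg (fun a => (hf0 n x a _).1) (hfsum n x _) (hq0 n x),
      sum_paddedResponse (hq1 n x)⟩
  have hgm (n x a) : Measurable fun ψ => paddedResponse (fun a => f n x a ψ) (q n x) a := by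
    unfold paddedResponse
    exact ((hfm n x a).const_mul _).add (((Finset.measurable_sum _ fun a' _ => hfm n x a').const_sub
      _).const_mul _)
  have hg1 (n x a ψ) : |paddedResponse (fun a => f n x a ψ) (q n x) a| ≤ 1 := by
    have := hP n (fun _ => ψ)
    rw [abs_of_nonneg ((this x).1 a)]
    exact this.le_one x a
  set Z : ℝ := ∑ s, bobWeight α θ s ^ N with hZdef
  have hZ : 0 < Z := Finset.sum_pos (fun s _ => pow_pos (hb s) N) ⟨0, by simp⟩
  obtain ⟨hwi, hw⟩ := integral_centralWeight_mul_prod (N := N) α θ (f := fun _ _ => 1)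
    (fun _ => measurable_const) (fun _ _ => by simp)
  have hwZ : ∫ l, centralWeight N α θ l = Z := by
    have hint (s t : Fin 2) : ∫ ψ, bobHidden α θ s t ψ =
        if s = t then (bobWeight α θ s : ℂ) else 0 := by
      simp only [bobHidden]
      rw [integral_const_mul, integral_hidden]
      by_cases hst : s = t
      · subst hst
        simp only [if_true, mul_one]
        exact_mod_cast Real.mul_self_sqrt (hb s).le
      · simp [hst]
    simp only [Finset.prod_const_one, mul_one, Complex.ofReal_one, one_mul, hint,
      Finset.prod_const, Finset.card_univ, Fintype.card_fin, ite_pow, zero_pow hN,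
      Finset.sum_ite_eq, Finset.mem_univ, if_true] at hw
    exact_mod_cast hw
  simp only [Finset.prod_const_one, mul_one] at hwi
  have hdm : Measurable fun l => ENNReal.ofReal (Z⁻¹ * centralWeight N α θ l) :=
    ((continuous_centralWeight N α θ).measurable.const_mul _).ennreal_ofReal
  have hd0 (l) : 0 ≤ Z⁻¹ * centralWeight N α θ l :=
    mul_nonneg (inv_nonneg.2 hZ.le) (Complex.normSq_nonneg _)
  refine ⟨Fin N → Fin 2 → ℂ, inferInstance,
    volume.withDensity fun l => ENNReal.ofReal (Z⁻¹ * centralWeight N α θ l), P, ⟨?_⟩, hP,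
    fun n x a => (hgm n x a).comp (measurable_pi_apply n), fun x a => ?_⟩
  · rw [withDensity_apply _ MeasurableSet.univ, Measure.restrict_univ,
      ← ofReal_integral_eq_lintegral_ofReal (hwi.const_mul _) (Filter.Eventually.of_forall hd0),
      integral_const_mul, hwZ, inv_mul_cancel₀ hZ.ne', ENNReal.ofReal_one]
  · rw [integral_withDensity_eq_integral_toReal_smul hdm
      (Filter.Eventually.of_forall fun l => ENNReal.ofReal_lt_top)]
    obtain ⟨-, h⟩ := integral_centralWeight_mul_prod (N := N) α θ
      (f := fun n ψ => paddedResponse (fun a => f n (x n) a ψ) (q n (x n)) (a n))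
      (fun n => hgm n (x n) (a n)) (fun n ψ => hg1 n (x n) (a n) ψ)
    simp_rw [fun n s t => integral_paddedResponse hb (hM n (x n)).2 (hfm n (x n)) (hf2 n (x n))
      (hf n (x n)) (hq n (x n)) (a n) s t] at h
    have hint : ∫ l : Fin N → Fin 2 → ℂ, (ENNReal.ofReal (Z⁻¹ * centralWeight N α θ l)).toReal •
        ∏ n, P n l (x n) (a n) = Z⁻¹ * ∫ l, centralWeight N α θ l *
          ∏ n, paddedResponse (fun a => f n (x n) a (l n)) (q n (x n)) (a n) := by
      rw [← integral_const_mul]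
      refine integral_congr_ae (Filter.Eventually.of_forall fun l => ?_)
      simp only [ENNReal.toReal_ofReal (hd0 l), smul_eq_mul, P]
      ring
    rw [hint, born, trace_rhoGME_mul_tensor, trace_networkOp hN, ← hZdef]
    simp_rw [Finset.prod_mul_distrib, ← Finset.mul_sum, Finset.prod_const, Finset.card_univ,
      Fintype.card_fin] at h
    have e : (1 / 2 ^ N : ℂ) * (Z : ℂ)⁻¹ * ∑ s, ∑ t, ∏ n, blockFun α θ s t (M n (x n) (a n)) =
        ((Z⁻¹ * ∫ l, centralWeight N α θ l *
          ∏ n, paddedResponse (fun a => f n (x n) a (l n)) (q n (x n)) (a n) : ℝ) : ℂ) := by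
      rw [Complex.ofReal_mul, h, Complex.ofReal_inv, _root_.one_div_pow]
      ring
    rw [e, Complex.ofReal_re]

/-! ### The parameter range -/

/-- The required lower bound on `cos² 2θ` is strictly below `1`, with margin governed by `(1 - α)³
(1 + α) > 0`, and `cos² 2θ → 1` as `θ → 0`. -/
lemma exists_unsteerableCond {α : ℝ} (hα : 19 / 20 ≤ α) (hα1 : α < 1) :
    ∃ θ ∈ Set.Ioc (0 : ℝ) (Real.pi / 4), UnsteerableCond α θ := by
  have hq : 0 < (2 - α) * α ^ 3 := mul_pos (by linarith) (by positivity)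
  have h1 : (2 * α - 1) / ((2 - α) * α ^ 3) < 1 := by
    rw [div_lt_one hq]
    have : 0 < (1 - α) ^ 3 * (1 + α) := mul_pos (pow_pos (by linarith) 3) (by linarith)
    nlinarith
  have hc : Filter.Tendsto (fun θ : ℝ => Real.cos (2 * θ) ^ 2) (nhds 0) (nhds 1) := by
    have : Continuous fun θ : ℝ => Real.cos (2 * θ) ^ 2 := by fun_prop
    simpa using this.tendsto 0
  have hev : ∀ᶠ θ in nhdsWithin (0 : ℝ) (Set.Ioi 0), UnsteerableCond α θ :=
    ((hc.eventually (lt_mem_nhds h1)).filter_mono nhdsWithin_le_nhds).mono fun θ h => h.le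
  have hev2 : ∀ᶠ θ in nhdsWithin (0 : ℝ) (Set.Ioi 0), θ ∈ Set.Ioc (0 : ℝ) (Real.pi / 4) :=
    Ioc_mem_nhdsGT (by positivity)
  obtain ⟨θ, h⟩ := (hev2.and hev).exists
  exact ⟨θ, h.1, h.2⟩

lemma cos_sin_tan_of_mem {θ : ℝ} (hθ : θ ∈ Set.Ioc (0 : ℝ) (Real.pi / 4)) :
    Real.cos θ ≠ 0 ∧ Real.sin θ ≠ 0 ∧ Real.tan θ ^ 2 ≤ 1 := by
  have hpi := Real.pi_pos
  have hc : 0 < Real.cos θ := Real.cos_pos_of_mem_Ioo ⟨by linarith [hθ.1], by linarith [hθ.2]⟩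
  have hs : 0 < Real.sin θ := Real.sin_pos_of_pos_of_lt_pi hθ.1 (by linarith [hθ.2])
  refine ⟨hc.ne', hs.ne', ?_⟩
  rw [Real.tan_eq_sin_div_cos, div_pow, div_le_one (by positivity)]
  have h2 : 0 ≤ Real.cos (2 * θ) := Real.cos_nonneg_of_neg_pi_div_two_le_of_le
    (by linarith [hθ.1]) (by linarith [hθ.2])
  rw [Real.cos_two_mul'] at h2
  linarith

end

end HiddenNonlocality

/-! ### The main theorem. -/

open HiddenNonlocality Filter Topology
theorem mainTheorem5 (N : ℕ) (hN : 2 ≤ N) :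
    (∀ α ∈ Set.Icc (0 : ℝ) 1, ∀ θ ∈ Set.Ioc (0 : ℝ) (Real.pi / 4),
      IsState (rhoGME N α θ) ∧
      IsState (filtered (Real.tan θ) (rhoGME N α θ)) ∧
      fidelityPure (filtered (Real.tan θ) (rhoGME N α θ)) (ghz N) =
        ((1 / 2 * (α ^ N + ((1 + α) / 2) ^ N + ((1 - α) / 2) ^ N) : ℝ) : ℂ)) ∧
    (∀ θ : ℝ → ℝ, (∀ α, θ α ∈ Set.Ioc (0 : ℝ) (Real.pi / 4)) →
      Tendsto (fun α => fidelityPure (filtered (Real.tan (θ α)) (rhoGME N α (θ α))) (ghz N))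
        (𝓝[<] 1) (𝓝 1)) ∧
    ∃ α₀ ∈ Set.Ico (0 : ℝ) 1, ∀ α ∈ Set.Ioo α₀ 1,
      (∃ θ ∈ Set.Ioc (0 : ℝ) (Real.pi / 4), UnsteerableCond α θ) ∧
      ∀ θ ∈ Set.Ioc (0 : ℝ) (Real.pi / 4),
        IsGME (rhoGME N α θ) ∧
        (UnsteerableCond α θ → IsFullyLocal (rhoGME N α θ)) ∧
        IsGMNL (filtered (Real.tan θ) (rhoGME N α θ)) ∧
        IsSeqGMNL (rhoGME N α θ) := by
  have hN0 : N ≠ 0 := by omega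
  -- Above `α₀ = 1 - 1/(10 N)`, Bernoulli's inequality gives `α ^ N ≥ 9/10`, more than the required
  -- `3/4`, and `N ≥ 2` gives the `α ≥ 19/20` needed for the local model.
  refine ⟨fun α hα θ hθ => ?_, fun θ hθ => ?_, 1 - 1 / (10 * N), ?_, fun α hα => ?_⟩
  · obtain ⟨hc, hs, -⟩ := cos_sin_tan_of_mem hθ
    exact ⟨⟨rhoGME_posSemidef hα θ, trace_rhoGME hN0 hα hc hs⟩, isState_filtered hN0 hα hc hs,
      fidelity_filtered hN0 hα hc hs⟩
  · have hcont : Continuous fun α : ℝ =>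
        ((1 / 2 * (α ^ N + ((1 + α) / 2) ^ N + ((1 - α) / 2) ^ N) : ℝ) : ℂ) := by fun_prop
    have hlim := (hcont.tendsto 1).mono_left (nhdsWithin_le_nhds (s := Set.Iio 1))
    have h1 : ((1 / 2 * ((1 : ℝ) ^ N + ((1 + 1) / 2) ^ N + ((1 - 1) / 2) ^ N) : ℝ) : ℂ) = 1 := by
      norm_num [hN0]
    rw [h1] at hlim
    refine hlim.congr' ?_
    have : ∀ᶠ α in 𝓝[<] (1 : ℝ), α ∈ Set.Ico (0 : ℝ) 1 := Ico_mem_nhdsLT one_pos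
    filter_upwards [this] with α hα
    obtain ⟨hc, hs, -⟩ := cos_sin_tan_of_mem (hθ α)
    exact (fidelity_filtered hN0 ⟨hα.1, hα.2.le⟩ hc hs).symm
  · have h1 : (1 : ℝ) ≤ N := by exact_mod_cast Nat.one_le_iff_ne_zero.2 hN0
    have h2 : 1 / (10 * (N : ℝ)) ≤ 1 := by
      rw [div_le_one (by positivity)]
      linarith
    have h3 : 0 < 1 / (10 * (N : ℝ)) := by positivity
    exact ⟨by linarith, by linarith⟩
  · have hN2 : (2 : ℝ) ≤ N := by exact_mod_cast hN
    have hα19 : 19 / 20 ≤ α := by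
      have : 1 / (10 * (N : ℝ)) ≤ 1 / 20 := one_div_le_one_div_of_le (by norm_num) (by linarith)
      linarith [hα.1]
    have hpow : 3 / 4 ≤ α ^ N := by
      have h1 := one_add_mul_le_pow (a := α - 1) (by linarith) N
      have h2 : (N : ℝ) * (1 - α) ≤ 1 / 10 := by
        have h3 : 1 - α ≤ 1 / (10 * (N : ℝ)) := by linarith [hα.1]
        calc (N : ℝ) * (1 - α) ≤ N * (1 / (10 * N)) :=
              mul_le_mul_of_nonneg_left h3 (by positivity)
          _ = 1 / 10 := by field_simp
      rw [add_sub_cancel] at h1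
      linarith
    have hαI : α ∈ Set.Icc (0 : ℝ) 1 := ⟨by linarith, hα.2.le⟩
    refine ⟨exists_unsteerableCond hα19 hα.2, fun θ hθ => ?_⟩
    obtain ⟨hc, hs, ht⟩ := cos_sin_tan_of_mem hθ
    exact ⟨rhoGME_isGME hN0 hαI hpow hc hs,
      rhoGME_isFullyLocal hN0 hα19 hα.2 hθ hc hs,
      filtered_isGMNL hN0 hαI hpow hc hs,
      rhoGME_isSeqGMNL hN0 hαI hpow hc hs ht⟩
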